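/- Let $k$ be a commutative ring and let $\mathcal{C}$ be a $k$-linear Grothendieck category (an abelian category with exact filtered colimits and a generator). Linear sites. Let $\mathfrak{a}$ be a $k$-linear category. A (linear) sieve on $A\in\mathfrak{a}$ is a submodule $R\subseteq\mathfrak{a}(-,A)$; for $g:A'\to A$ put $g^{-1}R=\{f \mid gf\in R\}$. A Grothendieck topology $\mathscr{T}$ on $\mathfrak{a}$ assigns to each $A$ a family $\mathscr{T}(A)$ of sieves on $A$, the covers, such that $\mathfrak{a}(-,A)\in\mathscr{T}(A)$; if $R\in\mathscr{T}(A)$ and $g:A'\to A$, then $g^{-1}R\in\mathscr{T}(A')$; and if $R$ is a sieve on $A$ and there is $S\in\mathscr{T}(A)$ with $g^{-1}R\in\mathscr{T}(A')$ for all $g:A'\to A$ in $S$, then $R\in\mathscr{T}(A)$. A family of morphisms to $A$ is covering if the sieve it generates is a cover. A presheaf $P:\mathfrak{a}^{op}\to \mathrm{Mod}(k)$ is a sheaf if $P(A)\to \mathrm{Hom}(R,P)$ is bijective for all $A$ and all $R\in\mathscr{T}(A)$. The canonical topology is the largest topology for which all representable presheaves are sheaves. A $k$-linear site is a $k$-linear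 category with a Grothendieck topology. LC morphisms. A $k$-linear functor $f:(\mathfrak{a},\mathscr{T}_{\mathfrak{a}})\to(\mathfrak{c},\mathscr{T}_{\mathfrak{c}})$ between $k$-linear sites is an LC morphism if (G) each $C\in\mathfrak{c}$ has a covering family $(f(A_i)\to C)_i$; (F) for each $c:f(A)\to f(A')$ there are a covering family $(a_i:A_i\to A)_i$ and morphisms $f_i:A_i\to A'$ with $c\,f(a_i)=f(f_i)$; (FF) for each $a:A\to A'$ with $f(a)=0$ there is a covering family $(a_i:A_i\to A)_i$ with $a a_i=0$; and $\mathscr{T}_{\mathfrak{a}}=f^{-1}\mathscr{T}_{\mathfrak{c}}$, that is, a sieve $R$ on $A$ is a cover if and only if the sieve on $f(A)$ generated by $f(R)$ is a cover. Let $\mathcal{J}_{\mathcal{C}}$ be the category whose objects are the LC morphisms $u_{\mathfrak{a}}:(\mathfrak{a},\mathscr{T}_{\mathfrak{a}})\to\mathcal{C}$ from small $k$-linear sites to $\mathcal{C}$ with its canonical topology, and whose morphisms $u_{\mathfrak{a}}\to u_{\mathfrak{b}}$ are the LC morphisms $f:\mathfrak{a}\to\mathfrak{b}$ with $u_{\mathfrak{b}}\circ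 f=u_{\mathfrak{a}}$. Let $G_{\mathcal{C}}:\mathcal{J}_{\mathcal{C}}\to\mathsf{Cat}$ be the functor sending $u_{\mathfrak{a}}$ to its domain $\mathfrak{a}$ and $f$ to $f$. For a filtered category $\mathcal{I}$ and a functor $F:\mathcal{I}\to\mathsf{Cat}$, the filtered colimit $\mathcal{L}(F)$ is the category with objects the pairs $(x,A)$ with $A\in\mathcal{I}$, $x\in F(A)$, and with morphisms $(x,A)\to(y,B)$ the classes $[(u,f,v)]$ of triples with $u:A\to C$, $v:B\to C$ in $\mathcal{I}$ and $f:F(u)(x)\to F(v)(y)$ in $F(C)$, where $(u_1,f_1,v_1)$ and $(u_2,f_2,v_2)$ are identified if there are $w_1,w_2$ with a common target such that $w_1u_1=w_2u_2$, $w_1v_1=w_2v_2$ and $F(w_1)(f_1)=F(w_2)(f_2)$; composition is computed after passing to a common target. (It represents the pseudonatural transformations from $F$ to constant functors.) If $F$ takes values in $k$-linear categories and functors, $\mathcal{L}(F)$ is $k$-linear. Theorem. The category $\mathcal{J}_{\mathcal{C}}$ is filtered, and $\mathcal{C}$ is the $k$-linear filtered colimit of $G_{\mathcal{C}}$: the functor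 $\psi_{\mathcal{C}}:\mathcal{L}(G_{\mathcal{C}})\to\mathcal{C}$ given by $(x,u_{\mathfrak{a}})\mapsto u_{\mathfrak{a}}(x)$ on objects and by $[(u,f,v)]\mapsto u_{\mathfrak{c}}(f)$ on morphisms, where $u_{\mathfrak{c}}$ is the common target of $u$ and $v$, is a $k$-linear equivalence of categories. -/

import Mathlib

open CategoryTheory

universe w v u v₁ u₁ v₂ u₂ v₃ u₃

set_option linter.unusedSectionVars false

noncomputable section

namespace FilteredColim

variable {I : Type u₁} [Category.{v₁} I] (F : I ⥤ Cat.{v₂, u₂})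

/-- Objects of the filtered colimit of `F`: pairs `(x, A)` with `A : I` and `x : F(A)`. -/
structure Obj where
  base : I
  fiber : F.obj base

variable {F}

/-- For `w : C ⟶ D`, the functor `F(w)` sends `f : F(u)(x) ⟶ F(v)(y)` to a morphism
`F(u ≫ w)(x) ⟶ F(v ≫ w)(y)`. -/
def push {A B C D : I} {x : F.obj A} {y : F.obj B} {u : A ⟶ C} {v : B ⟶ C}
    {u' : A ⟶ D} {v' : B ⟶ D} (w : C ⟶ D) (hu : u ≫ w = u') (hv : v ≫ w = v')
    (f : (F.map u).toFunctor.obj x ⟶ (F.map v).toFunctor.obj y) :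
    (F.map u').toFunctor.obj x ⟶ (F.map v').toFunctor.obj y :=
  eqToHom (by subst hu; simp) ≫ (F.map w).toFunctor.map f ≫ eqToHom (by subst hv; simp)

lemma push_id {A B C : I} {x : F.obj A} {y : F.obj B} {u : A ⟶ C} {v : B ⟶ C}
    (hu : u ≫ 𝟙 C = u) (hv : v ≫ 𝟙 C = v)
    (f : (F.map u).toFunctor.obj x ⟶ (F.map v).toFunctor.obj y) :
    push (𝟙 C) hu hv f = f := by
  have := Functor.congr_hom congr($(F.map_id C).toFunctor) f
  simp [push, this]

lemma push_push {A B C D E : I} {x : F.obj A} {y : F.obj B} {u : A ⟶ C} {v : B ⟶ C}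
    {u' : A ⟶ D} {v' : B ⟶ D} {u'' : A ⟶ E} {v'' : B ⟶ E} (w : C ⟶ D) (w' : D ⟶ E)
    (hu : u ≫ w = u') (hv : v ≫ w = v') (hu' : u' ≫ w' = u'') (hv' : v' ≫ w' = v'')
    (f : (F.map u).toFunctor.obj x ⟶ (F.map v).toFunctor.obj y) :
    push w' hu' hv' (push w hu hv f) =
      push (w ≫ w') (by rw [← Category.assoc, hu, hu']) (by rw [← Category.assoc, hv, hv']) f := by
  have := Functor.congr_hom congr($(F.map_comp w w').toFunctor) f
  simp [push, this, eqToHom_map]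

lemma push_comp {A B B' C D : I} {x : F.obj A} {y : F.obj B} {z : F.obj B'}
    {u : A ⟶ C} {v : B ⟶ C} {t : B' ⟶ C}
    {u' : A ⟶ D} {v' : B ⟶ D} {t' : B' ⟶ D} (w : C ⟶ D)
    (hu : u ≫ w = u') (hv : v ≫ w = v') (ht : t ≫ w = t')
    (f : (F.map u).toFunctor.obj x ⟶ (F.map v).toFunctor.obj y)
    (g : (F.map v).toFunctor.obj y ⟶ (F.map t).toFunctor.obj z) :
    push w hu ht (f ≫ g) = push w hu hv f ≫ push w hv ht g := by
  simp [push]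

lemma push_congr {A B C D : I} {x : F.obj A} {y : F.obj B} {u : A ⟶ C} {v : B ⟶ C}
    {u' : A ⟶ D} {v' : B ⟶ D} {w w' : C ⟶ D} (h : w = w') (hu : u ≫ w = u') (hv : v ≫ w = v')
    (f : (F.map u).toFunctor.obj x ⟶ (F.map v).toFunctor.obj y) :
    push w hu hv f = push w' (h ▸ hu) (h ▸ hv) f := by
  subst h; rfl

lemma push_identity {A C D : I} {x : F.obj A} {u : A ⟶ C} {u' : A ⟶ D} (w : C ⟶ D)
    (hu : u ≫ w = u') : push w hu hu (𝟙 ((F.map u).toFunctor.obj x)) = 𝟙 _ := by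
  simp [push]

lemma push_add [∀ i, Preadditive (F.obj i)] [∀ {i j : I} (f : i ⟶ j), (F.map f).toFunctor.Additive]
    {A B C D : I} {x : F.obj A} {y : F.obj B} {u : A ⟶ C} {v : B ⟶ C}
    {u' : A ⟶ D} {v' : B ⟶ D} (w : C ⟶ D) (hu : u ≫ w = u') (hv : v ≫ w = v')
    (f g : (F.map u).toFunctor.obj x ⟶ (F.map v).toFunctor.obj y) :
    push w hu hv (f + g) = push w hu hv f + push w hu hv g := by
  simp [push, Functor.map_add]

lemma push_smul (k : Type w) [CommRing k] [∀ i, Preadditive (F.obj i)] [∀ i, Linear k (F.obj i)]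
    [∀ {i j : I} (f : i ⟶ j), (F.map f).toFunctor.Linear k]
    {A B C D : I} {x : F.obj A} {y : F.obj B} {u : A ⟶ C} {v : B ⟶ C}
    {u' : A ⟶ D} {v' : B ⟶ D} (w : C ⟶ D) (hu : u ≫ w = u') (hv : v ≫ w = v') (c : k)
    (f : (F.map u).toFunctor.obj x ⟶ (F.map v).toFunctor.obj y) :
    push w hu hv (c • f) = c • push w hu hv f := by
  simp [push]

/-- Premorphisms `(x, A) ⟶ (y, B)`: triples `(u, f, v)` with `u : A ⟶ C`, `v : B ⟶ C` in `I` and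
`f : F(u)(x) ⟶ F(v)(y)` in `F(C)`. -/
structure PreHom (X Y : Obj F) where
  apex : I
  left : X.base ⟶ apex
  right : Y.base ⟶ apex
  hom : (F.map left).toFunctor.obj X.fiber ⟶ (F.map right).toFunctor.obj Y.fiber

/-- `(u₁, f₁, v₁)` and `(u₂, f₂, v₂)` are homotopical if there are `w₁`, `w₂` with a common target
such that `w₁u₁ = w₂u₂`, `w₁v₁ = w₂v₂` and `F(w₁)(f₁) = F(w₂)(f₂)`. -/
def Homotopic {X Y : Obj F} (p q : PreHom X Y) : Prop :=
  ∃ (D : I) (w₁ : p.apex ⟶ D) (w₂ : q.apex ⟶ D) (hl : q.left ≫ w₂ = p.left ≫ w₁)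
    (hr : q.right ≫ w₂ = p.right ≫ w₁), push w₁ rfl rfl p.hom = push w₂ hl hr q.hom

lemma Homotopic.refl {X Y : Obj F} (p : PreHom X Y) : Homotopic p p :=
  ⟨p.apex, 𝟙 _, 𝟙 _, rfl, rfl, rfl⟩

lemma Homotopic.symm {X Y : Obj F} {p q : PreHom X Y} (h : Homotopic p q) : Homotopic q p := by
  obtain ⟨D, w₁, w₂, hl, hr, e⟩ := h
  refine ⟨D, w₂, w₁, hl.symm, hr.symm, ?_⟩
  have key : ∀ {u' u'' : X.base ⟶ D} {v' v'' : Y.base ⟶ D} (h₁ : p.left ≫ w₁ = u')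
      (h₂ : p.right ≫ w₁ = v') (h₃ : q.left ≫ w₂ = u') (h₄ : q.right ≫ w₂ = v')
      (hu : u' = u'') (hv : v' = v''),
      push w₁ h₁ h₂ p.hom = push w₂ h₃ h₄ q.hom →
      push w₂ (h₃.trans hu) (h₄.trans hv) q.hom = push w₁ (h₁.trans hu) (h₂.trans hv) p.hom := by
    intro u' u'' v' v'' h₁ h₂ h₃ h₄ hu hv e
    subst hu hv
    exact e.symm
  exact key rfl rfl hl hr hl.symm hr.symm e

section

variable [IsFiltered I]

lemma Homotopic.trans {X Y : Obj F} {p q r : PreHom X Y} (h : Homotopic p q)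
    (h' : Homotopic q r) : Homotopic p r := by
  obtain ⟨D, w₁, w₂, hl, hr, e⟩ := h
  obtain ⟨E, z₁, z₂, hl', hr', e'⟩ := h'
  obtain ⟨T, a, b, hab⟩ := IsFiltered.span w₂ z₁
  have key : ∀ {u' : X.base ⟶ T} {v' : Y.base ⟶ T}
      (h₁ : p.left ≫ w₁ ≫ a = u') (h₂ : p.right ≫ w₁ ≫ a = v')
      (h₃ : r.left ≫ z₂ ≫ b = u') (h₄ : r.right ≫ z₂ ≫ b = v'),
      push (w₁ ≫ a) h₁ h₂ p.hom = push (z₂ ≫ b) h₃ h₄ r.hom := by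
    intro u' v' h₁ h₂ h₃ h₄
    rw [← push_push w₁ a rfl rfl (by simpa using h₁) (by simpa using h₂), e, push_push,
      push_congr hab, ← push_push z₁ b rfl rfl
        (by rw [← h₁, ← Category.assoc, ← hl, Category.assoc, Category.assoc, hab])
        (by rw [← h₂, ← Category.assoc, ← hr, Category.assoc, Category.assoc, hab]), e', push_push]
  refine ⟨T, w₁ ≫ a, z₂ ≫ b, ?_, ?_, key _ _ _ _⟩
  · rw [← Category.assoc, hl', Category.assoc, ← hab, ← Category.assoc, hl, Category.assoc]
  · rw [← Category.assoc, hr', Category.assoc, ← hab, ← Category.assoc, hr, Category.assoc]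

instance homSetoid (X Y : Obj F) : Setoid (PreHom X Y) where
  r := Homotopic
  iseqv :=
    { refl := Homotopic.refl
      symm := Homotopic.symm
      trans := Homotopic.trans }

/-- Morphisms of the filtered colimit: premorphisms up to homotopy. -/
def Hom (X Y : Obj F) := Quotient (homSetoid X Y)

/-- The class of the premorphism `(u, f, v)`. -/
def homMk {X Y : Obj F} {C : I} (u : X.base ⟶ C) (v : Y.base ⟶ C)
    (f : (F.map u).toFunctor.obj X.fiber ⟶ (F.map v).toFunctor.obj Y.fiber) : Hom X Y :=
  Quotient.mk _ ⟨C, u, v, f⟩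

lemma homMk_push {X Y : Obj F} {C D : I} {u : X.base ⟶ C} {v : Y.base ⟶ C}
    {u' : X.base ⟶ D} {v' : Y.base ⟶ D} (w : C ⟶ D) (hu : u ≫ w = u') (hv : v ≫ w = v')
    (f : (F.map u).toFunctor.obj X.fiber ⟶ (F.map v).toFunctor.obj Y.fiber) :
    homMk u' v' (push w hu hv f) = homMk u v f := by
  subst hu hv
  exact Quotient.sound ⟨D, 𝟙 _, w, by simp, by simp, by rw [push_push]; exact push_congr (by simp) _ _ _⟩

lemma homMk_eq_iff {X Y : Obj F} {C C' : I} {u : X.base ⟶ C} {v : Y.base ⟶ C}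
    {u' : X.base ⟶ C'} {v' : Y.base ⟶ C'}
    {f : (F.map u).toFunctor.obj X.fiber ⟶ (F.map v).toFunctor.obj Y.fiber}
    {f' : (F.map u').toFunctor.obj X.fiber ⟶ (F.map v').toFunctor.obj Y.fiber} :
    homMk u v f = homMk u' v' f' ↔ ∃ (D : I) (w₁ : C ⟶ D) (w₂ : C' ⟶ D) (hl : u' ≫ w₂ = u ≫ w₁)
    (hr : v' ≫ w₂ = v ≫ w₁), push w₁ rfl rfl f = push w₂ hl hr f' :=
  Quotient.eq

lemma exists_rep {X Y : Obj F} (f : Hom X Y) : ∃ (C : I) (u : X.base ⟶ C) (v : Y.base ⟶ C)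
    (f' : (F.map u).toFunctor.obj X.fiber ⟶ (F.map v).toFunctor.obj Y.fiber), f = homMk u v f' := by
  induction f using Quotient.inductionOn with
  | h p => exact ⟨p.apex, p.left, p.right, p.hom, rfl⟩

/-- Composite of two premorphisms, after completing the cospan by `s₁`, `s₂`. -/
def PreHom.glue {X Y Z : Obj F} (p : PreHom X Y) (q : PreHom Y Z) {D : I} (s₁ : p.apex ⟶ D)
    (s₂ : q.apex ⟶ D) (h : p.right ≫ s₁ = q.left ≫ s₂) : Hom X Z :=
  homMk (X := X) (Y := Z) (p.left ≫ s₁) (q.right ≫ s₂) (push s₁ rfl h p.hom ≫ push s₂ rfl rfl q.hom)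

lemma glue_push {X Y Z : Obj F} (p : PreHom X Y) (q : PreHom Y Z) {D E : I} (s₁ : p.apex ⟶ D)
    (s₂ : q.apex ⟶ D) (h : p.right ≫ s₁ = q.left ≫ s₂) (t : D ⟶ E) {u' : X.base ⟶ E}
    {m' : Y.base ⟶ E} {v' : Z.base ⟶ E} (h₁ : p.left ≫ s₁ ≫ t = u') (h₂ : p.right ≫ s₁ ≫ t = m')
    (h₃ : q.left ≫ s₂ ≫ t = m') (h₄ : q.right ≫ s₂ ≫ t = v') :
    p.glue q s₁ s₂ h = homMk u' v' (push (s₁ ≫ t) h₁ h₂ p.hom ≫ push (s₂ ≫ t) h₃ h₄ q.hom) := by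
  rw [PreHom.glue, ← homMk_push t (by simpa using h₁) (by simpa using h₄),
    push_comp t _ (by simpa using h₃) _, push_push, push_push]

lemma glue_congr {X Y Z : Obj F} {p p' : PreHom X Y} {q q' : PreHom Y Z} (hp : Homotopic p p')
    (hq : Homotopic q q') {D D' : I} (s₁ : p.apex ⟶ D)
    (s₂ : q.apex ⟶ D) (h : p.right ≫ s₁ = q.left ≫ s₂) (s₁' : p'.apex ⟶ D')
    (s₂' : q'.apex ⟶ D') (h' : p'.right ≫ s₁' = q'.left ≫ s₂') :
    p.glue q s₁ s₂ h = p'.glue q' s₁' s₂' h' := by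
  obtain ⟨E, w, w', hl, hr, e⟩ := hp
  obtain ⟨E', z, z', hl', hr', e'⟩ := hq
  obtain ⟨T₁, a, b, h₁⟩ := IsFiltered.span s₁ w
  obtain ⟨T₂, c, t, h₂⟩ := IsFiltered.span s₁' (w' ≫ b)
  obtain ⟨T, r, d, h₃, h₄⟩ := IsFiltered.bowtie (s₂ ≫ a ≫ t) z (s₂' ≫ c) z'
  simp only [Category.assoc] at h₂ h₃ h₄
  have e₁ : s₁ ≫ a ≫ t ≫ r = w ≫ b ≫ t ≫ r := by rw [reassoc_of% h₁]
  have e₂ : s₁' ≫ c ≫ r = w' ≫ b ≫ t ≫ r := by rw [reassoc_of% h₂]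
  have i₁ : p.left ≫ w ≫ b ≫ t ≫ r = p'.left ≫ w' ≫ b ≫ t ≫ r := by
    rw [reassoc_of% hl]
  have i₂ : p.right ≫ w ≫ b ≫ t ≫ r = p'.right ≫ w' ≫ b ≫ t ≫ r := by
    rw [reassoc_of% hr]
  have i₃ : q.left ≫ z ≫ d = q'.left ≫ z' ≫ d := by rw [reassoc_of% hl']
  have i₄ : q.right ≫ z ≫ d = q'.right ≫ z' ≫ d := by rw [reassoc_of% hr']
  have m : p.right ≫ w ≫ b ≫ t ≫ r = q.left ≫ z ≫ d := by
    rw [← e₁, reassoc_of% h, h₃]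
  rw [glue_push p q s₁ s₂ h (a ≫ t ≫ r) (u' := p.left ≫ w ≫ b ≫ t ≫ r)
      (m' := p.right ≫ w ≫ b ≫ t ≫ r) (v' := q.right ≫ z ≫ d) (by rw [e₁]) (by rw [e₁])
      (by rw [h₃, m]) (by rw [h₃]),
    glue_push p' q' s₁' s₂' h' (c ≫ r) (u' := p.left ≫ w ≫ b ≫ t ≫ r)
      (m' := p.right ≫ w ≫ b ≫ t ≫ r) (v' := q.right ≫ z ≫ d) (by rw [e₂, i₁]) (by rw [e₂, i₂])
      (by rw [h₄, ← i₃, m]) (by rw [h₄, i₄]),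
    push_congr e₁, push_congr e₂, push_congr h₃, push_congr h₄,
    ← push_push w (b ≫ t ≫ r) rfl rfl (by simp) (by simp), e, push_push,
    ← push_push z d rfl rfl (by simp [m]) (by simp), e', push_push]

/-- Composition of morphisms in the filtered colimit: complete the inner cospan to a commutative
square and compose. -/
def comp {X Y Z : Obj F} : Hom X Y → Hom Y Z → Hom X Z :=
  Quotient.lift₂ (fun p q => p.glue q
      (IsFiltered.span p.right q.left).choose_spec.choose
      (IsFiltered.span p.right q.left).choose_spec.choose_spec.choose
      (IsFiltered.span p.right q.left).choose_spec.choose_spec.choose_spec)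
    (fun _ _ _ _ hp hq => glue_congr hp hq _ _ _ _ _ _)

/-- The composite can be computed with any completion of the cospan. -/
lemma comp_homMk {X Y Z : Obj F} {C C' D : I} (u : X.base ⟶ C) (v : Y.base ⟶ C)
    (f : (F.map u).toFunctor.obj X.fiber ⟶ (F.map v).toFunctor.obj Y.fiber)
    (u' : Y.base ⟶ C') (v' : Z.base ⟶ C')
    (f' : (F.map u').toFunctor.obj Y.fiber ⟶ (F.map v').toFunctor.obj Z.fiber)
    (s₁ : C ⟶ D) (s₂ : C' ⟶ D) (h : v ≫ s₁ = u' ≫ s₂) :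
    comp (homMk u v f) (homMk u' v' f') =
      homMk (u ≫ s₁) (v' ≫ s₂) (push s₁ rfl h f ≫ push s₂ rfl rfl f') :=
  glue_congr (p := ⟨C, u, v, f⟩) (p' := ⟨C, u, v, f⟩) (q := ⟨C', u', v', f'⟩)
    (q' := ⟨C', u', v', f'⟩) (Homotopic.refl _) (Homotopic.refl _) _ _ _ s₁ s₂ h

lemma comp_homMk_same {X Y Z : Obj F} {C : I} (u : X.base ⟶ C) (v : Y.base ⟶ C) (t : Z.base ⟶ C)
    (f : (F.map u).toFunctor.obj X.fiber ⟶ (F.map v).toFunctor.obj Y.fiber)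
    (g : (F.map v).toFunctor.obj Y.fiber ⟶ (F.map t).toFunctor.obj Z.fiber) :
    comp (homMk u v f) (homMk v t g) = homMk u t (f ≫ g) := by
  rw [comp_homMk u v f v t g (𝟙 C) (𝟙 C) rfl, ← push_comp, homMk_push]

/-- Two composable morphisms have representatives over the same object with the same inner leg. -/
lemma exists_rep_comp {X Y Z : Obj F} (f : Hom X Y) (g : Hom Y Z) :
    ∃ (C : I) (u : X.base ⟶ C) (v : Y.base ⟶ C) (t : Z.base ⟶ C)
      (f' : (F.map u).toFunctor.obj X.fiber ⟶ (F.map v).toFunctor.obj Y.fiber)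
      (g' : (F.map v).toFunctor.obj Y.fiber ⟶ (F.map t).toFunctor.obj Z.fiber),
      f = homMk u v f' ∧ g = homMk v t g' := by
  obtain ⟨C, u, v, f, rfl⟩ := exists_rep f
  obtain ⟨D, v', t, g, rfl⟩ := exists_rep g
  obtain ⟨E, a, b, h⟩ := IsFiltered.span v v'
  exact ⟨E, u ≫ a, v ≫ a, t ≫ b, push a rfl rfl f, push b h.symm rfl g, (homMk_push _ _ _ _).symm,
    (homMk_push _ _ _ _).symm⟩

/-- Two parallel morphisms have representatives over the same cospan. -/
lemma exists_rep_pair {X Y : Obj F} (f g : Hom X Y) :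
    ∃ (C : I) (u : X.base ⟶ C) (v : Y.base ⟶ C)
      (f' g' : (F.map u).toFunctor.obj X.fiber ⟶ (F.map v).toFunctor.obj Y.fiber),
      f = homMk u v f' ∧ g = homMk u v g' := by
  obtain ⟨C, u, v, f, rfl⟩ := exists_rep f
  obtain ⟨D, u', v', g, rfl⟩ := exists_rep g
  obtain ⟨E, a, b, h, h'⟩ := IsFiltered.bowtie u u' v v'
  exact ⟨E, u ≫ a, v ≫ a, push a rfl rfl f, push b h.symm h'.symm g, (homMk_push _ _ _ _).symm,
    (homMk_push _ _ _ _).symm⟩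

/-- Three parallel morphisms have representatives over the same cospan. -/
lemma exists_rep_triple {X Y : Obj F} (f g h : Hom X Y) :
    ∃ (C : I) (u : X.base ⟶ C) (v : Y.base ⟶ C)
      (f' g' h' : (F.map u).toFunctor.obj X.fiber ⟶ (F.map v).toFunctor.obj Y.fiber),
      f = homMk u v f' ∧ g = homMk u v g' ∧ h = homMk u v h' := by
  obtain ⟨C, u, v, f, g, rfl, rfl⟩ := exists_rep_pair f g
  obtain ⟨D, u', v', h, rfl⟩ := exists_rep h
  obtain ⟨E, a, b, e, e'⟩ := IsFiltered.bowtie u u' v v'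
  exact ⟨E, u ≫ a, v ≫ a, push a rfl rfl f, push a rfl rfl g, push b e.symm e'.symm h,
    (homMk_push _ _ _ _).symm, (homMk_push _ _ _ _).symm, (homMk_push _ _ _ _).symm⟩

instance category : Category (Obj F) where
  Hom := Hom
  id X := homMk (𝟙 X.base) (𝟙 X.base) (𝟙 _)
  comp := comp
  id_comp {X Y} f := by
    obtain ⟨C, u, v, f, rfl⟩ := exists_rep f
    rw [← homMk_push u (Category.id_comp u) (Category.id_comp u), comp_homMk_same, push_identity,
      Category.id_comp]
  comp_id {X Y} f := by
    obtain ⟨C, u, v, f, rfl⟩ := exists_rep f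
    rw [← homMk_push v (Category.id_comp v) (Category.id_comp v), comp_homMk_same, push_identity,
      Category.comp_id]
  assoc {X Y Z W} f g h := by
    obtain ⟨C, u, v, t, f, g, rfl, rfl⟩ := exists_rep_comp f g
    obtain ⟨D, t', s, h, rfl⟩ := exists_rep h
    obtain ⟨E, a, b, e⟩ := IsFiltered.span t t'
    rw [← homMk_push a rfl rfl f, ← homMk_push a rfl rfl g, ← homMk_push b e.symm rfl h]
    simp only [comp_homMk_same, Category.assoc]

lemma comp_def {X Y Z : Obj F} (f : X ⟶ Y) (g : Y ⟶ Z) : f ≫ g = comp f g := rfl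

lemma id_def (X : Obj F) : 𝟙 X = homMk (𝟙 X.base) (𝟙 X.base) (𝟙 _) := rfl

section Linear

variable [∀ i, Preadditive (F.obj i)] [∀ {i j : I} (f : i ⟶ j), (F.map f).toFunctor.Additive]

/-- Sum of two parallel premorphisms, after completing to a common cospan. -/
def PreHom.add {X Y : Obj F} (p q : PreHom X Y) {D : I} (s₁ : p.apex ⟶ D) (s₂ : q.apex ⟶ D)
    (h : p.left ≫ s₁ = q.left ≫ s₂) (h' : p.right ≫ s₁ = q.right ≫ s₂) : Hom X Y :=
  homMk (p.left ≫ s₁) (p.right ≫ s₁) (push s₁ rfl rfl p.hom + push s₂ h.symm h'.symm q.hom)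

lemma add_push {X Y : Obj F} (p q : PreHom X Y) {D E : I} (s₁ : p.apex ⟶ D)
    (s₂ : q.apex ⟶ D) (h : p.left ≫ s₁ = q.left ≫ s₂) (h' : p.right ≫ s₁ = q.right ≫ s₂)
    (t : D ⟶ E) {u' : X.base ⟶ E} {v' : Y.base ⟶ E} (h₁ : p.left ≫ s₁ ≫ t = u')
    (h₂ : p.right ≫ s₁ ≫ t = v') (h₃ : q.left ≫ s₂ ≫ t = u') (h₄ : q.right ≫ s₂ ≫ t = v') :
    p.add q s₁ s₂ h h' =
      homMk u' v' (push (s₁ ≫ t) h₁ h₂ p.hom + push (s₂ ≫ t) h₃ h₄ q.hom) := by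
  rw [PreHom.add, ← homMk_push t (by simpa using h₁) (by simpa using h₂),
    push_add, push_push, push_push]

lemma add_congr {X Y : Obj F} {p p' q q' : PreHom X Y} (hp : Homotopic p p')
    (hq : Homotopic q q') {D D' : I} (s₁ : p.apex ⟶ D) (s₂ : q.apex ⟶ D)
    (h : p.left ≫ s₁ = q.left ≫ s₂) (j : p.right ≫ s₁ = q.right ≫ s₂) (s₁' : p'.apex ⟶ D')
    (s₂' : q'.apex ⟶ D') (h' : p'.left ≫ s₁' = q'.left ≫ s₂')
    (j' : p'.right ≫ s₁' = q'.right ≫ s₂') :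
    p.add q s₁ s₂ h j = p'.add q' s₁' s₂' h' j' := by
  obtain ⟨E, w, w', hl, hr, e⟩ := hp
  obtain ⟨E', z, z', hl', hr', e'⟩ := hq
  obtain ⟨T₁, a, b, h₁⟩ := IsFiltered.span s₁ w
  obtain ⟨T₂, c, t, h₂⟩ := IsFiltered.span s₁' (w' ≫ b)
  obtain ⟨T, r, d, h₃, h₄⟩ := IsFiltered.bowtie (s₂ ≫ a ≫ t) z (s₂' ≫ c) z'
  simp only [Category.assoc] at h₂ h₃ h₄
  have e₁ : s₁ ≫ a ≫ t ≫ r = w ≫ b ≫ t ≫ r := by rw [reassoc_of% h₁]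
  have e₂ : s₁' ≫ c ≫ r = w' ≫ b ≫ t ≫ r := by rw [reassoc_of% h₂]
  have i₁ : p.left ≫ w ≫ b ≫ t ≫ r = p'.left ≫ w' ≫ b ≫ t ≫ r := by
    rw [reassoc_of% hl]
  have i₂ : p.right ≫ w ≫ b ≫ t ≫ r = p'.right ≫ w' ≫ b ≫ t ≫ r := by
    rw [reassoc_of% hr]
  have i₃ : q.left ≫ z ≫ d = q'.left ≫ z' ≫ d := by rw [reassoc_of% hl']
  have i₄ : q.right ≫ z ≫ d = q'.right ≫ z' ≫ d := by rw [reassoc_of% hr']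
  have m : p.left ≫ w ≫ b ≫ t ≫ r = q.left ≫ z ≫ d := by
    rw [← e₁, reassoc_of% h, h₃]
  have n : p.right ≫ w ≫ b ≫ t ≫ r = q.right ≫ z ≫ d := by
    rw [← e₁, reassoc_of% j, h₃]
  rw [add_push p q s₁ s₂ h j (a ≫ t ≫ r) (u' := p.left ≫ w ≫ b ≫ t ≫ r)
      (v' := p.right ≫ w ≫ b ≫ t ≫ r) (by rw [e₁]) (by rw [e₁]) (by rw [h₃, m]) (by rw [h₃, n]),
    add_push p' q' s₁' s₂' h' j' (c ≫ r) (u' := p.left ≫ w ≫ b ≫ t ≫ r)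
      (v' := p.right ≫ w ≫ b ≫ t ≫ r) (by rw [e₂, i₁]) (by rw [e₂, i₂])
      (by rw [h₄, ← i₃, m]) (by rw [h₄, ← i₄, n]),
    push_congr e₁, push_congr e₂, push_congr h₃, push_congr h₄,
    ← push_push w (b ≫ t ≫ r) rfl rfl (by simp) (by simp), e, push_push,
    ← push_push z d rfl rfl (by simp [m]) (by simp [n]), e', push_push]

instance (X Y : Obj F) : Add (Hom X Y) where
  add := Quotient.lift₂ (fun p q =>
      have H := IsFiltered.bowtie p.left q.left p.right q.right
      p.add q H.choose_spec.choose H.choose_spec.choose_spec.choose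
        H.choose_spec.choose_spec.choose_spec.1 H.choose_spec.choose_spec.choose_spec.2)
    (fun _ _ _ _ hp hq => add_congr hp hq _ _ _ _ _ _ _ _)

lemma homMk_add {X Y : Obj F} {C : I} (u : X.base ⟶ C) (v : Y.base ⟶ C)
    (f g : (F.map u).toFunctor.obj X.fiber ⟶ (F.map v).toFunctor.obj Y.fiber) :
    (homMk u v f : Hom X Y) + (homMk u v g : Hom X Y) = homMk u v (f + g) := by
  refine (add_congr (p := ⟨C, u, v, f⟩) (p' := ⟨C, u, v, f⟩) (q := ⟨C, u, v, g⟩)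
    (q' := ⟨C, u, v, g⟩) (Homotopic.refl _) (Homotopic.refl _) _ _
    (IsFiltered.bowtie u u v v).choose_spec.choose_spec.choose_spec.1
    (IsFiltered.bowtie u u v v).choose_spec.choose_spec.choose_spec.2 (𝟙 C) (𝟙 C) rfl
      rfl).trans ?_
  exact (congrArg _ (push_add ..).symm).trans (homMk_push (𝟙 C) rfl rfl (f + g))

instance (X Y : Obj F) : Zero (Hom X Y) where
  zero := homMk (IsFiltered.leftToMax X.base Y.base) (IsFiltered.rightToMax X.base Y.base) 0

lemma homMk_zero {X Y : Obj F} {C : I} (u : X.base ⟶ C) (v : Y.base ⟶ C) :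
    (homMk u v 0 : Hom X Y) = 0 := by
  obtain ⟨D, a, b, h, h'⟩ := IsFiltered.bowtie u (IsFiltered.leftToMax X.base Y.base) v
    (IsFiltered.rightToMax X.base Y.base)
  refine Quotient.sound ⟨D, a, b, h.symm, h'.symm, ?_⟩
  simp [push]

instance (X Y : Obj F) : Neg (Hom X Y) where
  neg := Quotient.map (fun p => ⟨p.apex, p.left, p.right, -p.hom⟩) (by
    rintro p q ⟨D, a, b, h, h', e⟩
    exact ⟨D, a, b, h, h', by simpa [push, Functor.map_neg] using e⟩)

lemma homMk_neg {X Y : Obj F} {C : I} (u : X.base ⟶ C) (v : Y.base ⟶ C)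
    (f : (F.map u).toFunctor.obj X.fiber ⟶ (F.map v).toFunctor.obj Y.fiber) :
    -(homMk u v f : Hom X Y) = homMk u v (-f) := rfl

instance addCommGroup (X Y : Obj F) : AddCommGroup (Hom X Y) where
  add_assoc f g h := by
    obtain ⟨C, u, v, f, g, h, rfl, rfl, rfl⟩ := exists_rep_triple f g h
    simp only [homMk_add, add_assoc]
  zero_add f := by
    obtain ⟨C, u, v, f, rfl⟩ := exists_rep f
    rw [← homMk_zero u v, homMk_add, zero_add]
  add_zero f := by
    obtain ⟨C, u, v, f, rfl⟩ := exists_rep f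
    rw [← homMk_zero u v, homMk_add, add_zero]
  add_comm f g := by
    obtain ⟨C, u, v, f, g, rfl, rfl⟩ := exists_rep_pair f g
    simp only [homMk_add, add_comm]
  neg_add_cancel f := by
    obtain ⟨C, u, v, f, rfl⟩ := exists_rep f
    rw [homMk_neg, homMk_add, neg_add_cancel, homMk_zero]
  nsmul := nsmulRec
  zsmul := zsmulRec

lemma add_comp {X Y Z : Obj F} (f g : Hom X Y) (h : Hom Y Z) :
    comp (f + g) h = comp f h + comp g h := by
  obtain ⟨C, u, v, f, g, rfl, rfl⟩ := exists_rep_pair f g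
  obtain ⟨D, v', t, h, rfl⟩ := exists_rep h
  obtain ⟨E, a, b, e⟩ := IsFiltered.span v v'
  rw [← homMk_push a rfl rfl f, ← homMk_push a rfl rfl g, ← homMk_push b e.symm rfl h]
  simp only [homMk_add, comp_homMk_same, Preadditive.add_comp]

lemma comp_add {X Y Z : Obj F} (h : Hom X Y) (f g : Hom Y Z) :
    comp h (f + g) = comp h f + comp h g := by
  obtain ⟨C, u, v, f, g, rfl, rfl⟩ := exists_rep_pair f g
  obtain ⟨D, t, u', h, rfl⟩ := exists_rep h
  obtain ⟨E, a, b, e⟩ := IsFiltered.span u u'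
  rw [← homMk_push a rfl rfl f, ← homMk_push a rfl rfl g, ← homMk_push b rfl e.symm h]
  simp only [homMk_add, comp_homMk_same, Preadditive.comp_add]

instance preadditive : Preadditive (Obj F) where
  homGroup := addCommGroup
  add_comp _ _ _ f g h := add_comp f g h
  comp_add _ _ _ h f g := comp_add h f g

variable (k : Type w) [CommRing k] [∀ i, Linear k (F.obj i)]
  [∀ {i j : I} (f : i ⟶ j), (F.map f).toFunctor.Linear k]

instance (X Y : Obj F) : SMul k (Hom X Y) where
  smul c := Quotient.map (fun p => ⟨p.apex, p.left, p.right, c • p.hom⟩) (by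
    rintro p q ⟨D, a, b, h, h', e⟩
    exact ⟨D, a, b, h, h', by rw [push_smul, push_smul, e]⟩)

lemma homMk_smul {X Y : Obj F} {C : I} (u : X.base ⟶ C) (v : Y.base ⟶ C) (c : k)
    (f : (F.map u).toFunctor.obj X.fiber ⟶ (F.map v).toFunctor.obj Y.fiber) :
    c • (homMk u v f : Hom X Y) = homMk u v (c • f) := rfl

instance module (X Y : Obj F) : Module k (Hom X Y) where
  one_smul f := by
    obtain ⟨C, u, v, f, rfl⟩ := exists_rep f
    rw [homMk_smul, one_smul]
  mul_smul a b f := by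
    obtain ⟨C, u, v, f, rfl⟩ := exists_rep f
    simp only [homMk_smul, mul_smul]
  smul_zero a := by
    rw [← homMk_zero (IsFiltered.leftToMax X.base Y.base) (IsFiltered.rightToMax X.base Y.base),
      homMk_smul, smul_zero]
  smul_add a f g := by
    obtain ⟨C, u, v, f, g, rfl, rfl⟩ := exists_rep_pair f g
    simp only [homMk_smul, homMk_add, smul_add]
  add_smul a b f := by
    obtain ⟨C, u, v, f, rfl⟩ := exists_rep f
    simp only [homMk_smul, homMk_add, add_smul]
  zero_smul f := by
    obtain ⟨C, u, v, f, rfl⟩ := exists_rep f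
    rw [homMk_smul, zero_smul, homMk_zero]

lemma smul_comp {X Y Z : Obj F} (c : k) (f : Hom X Y) (g : Hom Y Z) :
    comp (c • f) g = c • comp f g := by
  obtain ⟨C, u, v, t, f, g, rfl, rfl⟩ := exists_rep_comp f g
  simp only [homMk_smul, comp_homMk_same, Linear.smul_comp]

lemma comp_smul {X Y Z : Obj F} (f : Hom X Y) (c : k) (g : Hom Y Z) :
    comp f (c • g) = c • comp f g := by
  obtain ⟨C, u, v, t, f, g, rfl, rfl⟩ := exists_rep_comp f g
  simp only [homMk_smul, comp_homMk_same, Linear.comp_smul]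

instance linear : Linear k (Obj F) where
  homModule := module k
  smul_comp _ _ _ c f g := smul_comp k c f g
  comp_smul _ _ _ f c g := comp_smul k f c g

end Linear

end

variable (F) in
/-- Pseudonatural transformations from `F` to the constant functor with value `X`. -/
structure PseudoCocone (X : Type u₃) [Category.{v₃} X] where
  app : ∀ i : I, F.obj i ⥤ X
  iso : ∀ {i j : I} (f : i ⟶ j), (F.map f).toFunctor ⋙ app j ≅ app i
  iso_id : ∀ (i : I) (x : F.obj i), (iso (𝟙 i)).hom.app x = (app i).map (eqToHom (by simp))
  iso_comp : ∀ {i j l : I} (f : i ⟶ j) (g : j ⟶ l) (x : F.obj i),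
    (iso (f ≫ g)).hom.app x = (app l).map (eqToHom (by simp)) ≫
      (iso g).hom.app ((F.map f).toFunctor.obj x) ≫ (iso f).hom.app x

section UniversalProperty

variable {X : Type u₃} [Category.{v₃} X]

namespace PseudoCocone

/-- Modifications. -/
@[ext]
structure Modification (Φ Ψ : PseudoCocone F X) where
  app : ∀ i : I, Φ.app i ⟶ Ψ.app i
  naturality : ∀ {i j : I} (f : i ⟶ j) (x : F.obj i),
    (Φ.iso f).hom.app x ≫ (app i).app x =
      (app j).app ((F.map f).toFunctor.obj x) ≫ (Ψ.iso f).hom.app x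

instance : Category (PseudoCocone F X) where
  Hom := Modification
  id Φ := ⟨fun _ => 𝟙 _, by simp⟩
  comp r s := ⟨fun i => r.app i ≫ s.app i, fun f x => by
    simp only [NatTrans.comp_app, Category.assoc]
    rw [← s.naturality, ← Category.assoc, r.naturality, Category.assoc]⟩

lemma ext {Φ Ψ : PseudoCocone F X} (h : ∀ i, Φ.app i = Ψ.app i)
    (h' : ∀ {i j : I} (f : i ⟶ j) (x : F.obj i), (Φ.iso f).hom.app x =
      eqToHom (by simp [h]) ≫ (Ψ.iso f).hom.app x ≫ eqToHom (by simp [h])) : Φ = Ψ := by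
  obtain ⟨a, s, p, q⟩ := Φ
  obtain ⟨b, t, p', q'⟩ := Ψ
  obtain rfl : a = b := funext h
  have : @s = @t := by
    funext i j f
    ext x
    simpa using h' f x
  subst this
  rfl

lemma push_invariant (Φ : PseudoCocone F X) {A B C D : I} {x : F.obj A} {y : F.obj B} {u : A ⟶ C}
    {v : B ⟶ C} {u' : A ⟶ D} {v' : B ⟶ D} (w : C ⟶ D) (hu : u ≫ w = u') (hv : v ≫ w = v')
    (f : (F.map u).toFunctor.obj x ⟶ (F.map v).toFunctor.obj y) :
    (Φ.iso u').inv.app x ≫ (Φ.app D).map (push w hu hv f) ≫ (Φ.iso v').hom.app y =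
      (Φ.iso u).inv.app x ≫ (Φ.app C).map f ≫ (Φ.iso v).hom.app y := by
  subst hu hv
  rw [← cancel_epi ((Φ.iso (u ≫ w)).hom.app x), Iso.hom_inv_id_app_assoc]
  have := (Φ.iso w).hom.naturality f
  simp only [Functor.comp_map] at this
  simp only [iso_comp, push, Functor.map_comp, Category.assoc, Iso.hom_inv_id_app_assoc]
  rw [← reassoc_of% this]
  simp only [← Functor.map_comp_assoc, eqToHom_trans, eqToHom_refl, Category.comp_id]

end PseudoCocone

variable [IsFiltered I]

variable (F) in
/-- The structural pseudonatural transformation from `F` to its filtered colimit. -/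
def cocone : PseudoCocone F (Obj F) where
  app i :=
    { obj := fun x => ⟨i, x⟩
      map := fun {x y} f => homMk (X := ⟨i, x⟩) (Y := ⟨i, y⟩) (𝟙 i) (𝟙 i)
        ((F.map (𝟙 i)).toFunctor.map f)
      map_id := fun x => by simp [id_def]
      map_comp := fun f g => by
        rw [comp_def, comp_homMk_same, Functor.map_comp] }
  iso {i j} f := NatIso.ofComponents (fun x =>
    { hom := homMk (X := ⟨j, (F.map f).toFunctor.obj x⟩) (Y := ⟨i, x⟩) (𝟙 j) f
        (eqToHom (by simp))
      inv := homMk (X := ⟨i, x⟩) (Y := ⟨j, (F.map f).toFunctor.obj x⟩) f (𝟙 j)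
        (eqToHom (by simp))
      hom_inv_id := by simp [comp_def, comp_homMk_same, id_def]
      inv_hom_id := by
        rw [comp_def, comp_homMk_same, id_def, eqToHom_trans, eqToHom_refl]
        rw [← homMk_push f (Category.id_comp f) (Category.id_comp f) (𝟙 _), push_identity] })
    (fun {x y} g => by
      have h := Functor.congr_hom congr($(F.map_id i).toFunctor) g
      have h' := Functor.congr_hom congr($(F.map_id j).toFunctor) ((F.map f).toFunctor.map g)
      have e := homMk_push (X := ⟨i, x⟩) (Y := ⟨i, y⟩) f (Category.id_comp f) (Category.id_comp f)
        ((F.map (𝟙 i)).toFunctor.map g)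
      have e₁ := comp_homMk_same (X := ⟨j, (F.map f).toFunctor.obj x⟩)
        (Y := ⟨j, (F.map f).toFunctor.obj y⟩) (Z := ⟨i, y⟩) (𝟙 j) (𝟙 j) f
        ((F.map (𝟙 j)).toFunctor.map ((F.map f).toFunctor.map g)) (eqToHom (by simp))
      have e₂ := comp_homMk_same (X := ⟨j, (F.map f).toFunctor.obj x⟩)
        (Y := ⟨i, x⟩) (Z := ⟨i, y⟩) (𝟙 j) f f (eqToHom (by simp))
        (push f (Category.id_comp f) (Category.id_comp f) ((F.map (𝟙 i)).toFunctor.map g))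
      rw [e] at e₂
      refine e₁.trans (Eq.trans ?_ e₂.symm)
      congr 1
      simp [push, h, h', eqToHom_map])
  iso_id i x := by
    dsimp
    congr 1
    simp [eqToHom_map]
  iso_comp {i j l} f g x := by
    dsimp
    rw [← homMk_push g (Category.id_comp g) rfl (eqToHom _), comp_def, comp_def, comp_homMk_same,
      comp_homMk_same]
    congr 1
    simp [push, eqToHom_map]

/-- The structural functors are `k`-linear if `F` takes values in `k`-linear categories. -/
theorem cocone_linear (k : Type w) [CommRing k] [∀ i, Preadditive (F.obj i)]
    [∀ i, Linear k (F.obj i)] [∀ {i j : I} (f : i ⟶ j), (F.map f).toFunctor.Additive]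
    [∀ {i j : I} (f : i ⟶ j), (F.map f).toFunctor.Linear k] (i : I) :
    ((cocone F).app i).Additive ∧ ((cocone F).app i).Linear k :=
  ⟨⟨fun {x y f g} => (congrArg (homMk (X := ⟨i, x⟩) (Y := ⟨i, y⟩) (𝟙 i) (𝟙 i))
      ((F.map (𝟙 i)).toFunctor.map_add (f := f) (g := g))).trans (homMk_add _ _ _ _).symm⟩,
    ⟨fun {x y} f c => congrArg (homMk (X := ⟨i, x⟩) (Y := ⟨i, y⟩) (𝟙 i) (𝟙 i))
      ((F.map (𝟙 i)).toFunctor.map_smul c f)⟩⟩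

/-- The functor from the filtered colimit induced by a pseudonatural transformation. -/
def desc (Φ : PseudoCocone F X) : Obj F ⥤ X where
  obj x := (Φ.app x.base).obj x.fiber
  map {x y} := Quotient.lift (fun p => (Φ.iso p.left).inv.app x.fiber ≫ (Φ.app p.apex).map p.hom ≫
      (Φ.iso p.right).hom.app y.fiber) (by
    rintro p q ⟨D, w₁, w₂, hl, hr, e⟩
    rw [← Φ.push_invariant w₁ rfl rfl, e, Φ.push_invariant w₂])
  map_id x := by
    change (Φ.iso (𝟙 _)).inv.app x.fiber ≫ (Φ.app x.base).map (𝟙 _) ≫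
      (Φ.iso (𝟙 _)).hom.app x.fiber = _
    simp
  map_comp {x y z} f g := by
    obtain ⟨C, u, v, t, f, g, rfl, rfl⟩ := exists_rep_comp f g
    rw [comp_def, comp_homMk_same]
    change (Φ.iso u).inv.app x.fiber ≫ (Φ.app C).map (f ≫ g) ≫ (Φ.iso t).hom.app z.fiber =
      ((Φ.iso u).inv.app x.fiber ≫ (Φ.app C).map f ≫ (Φ.iso v).hom.app y.fiber) ≫
      ((Φ.iso v).inv.app y.fiber ≫ (Φ.app C).map g ≫ (Φ.iso t).hom.app z.fiber)
    simp

lemma desc_homMk (Φ : PseudoCocone F X) {x y : Obj F} {C : I} (u : x.base ⟶ C) (v : y.base ⟶ C)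
    (f : (F.map u).toFunctor.obj x.fiber ⟶ (F.map v).toFunctor.obj y.fiber) :
    (desc Φ).map (homMk u v f) = (Φ.iso u).inv.app x.fiber ≫ (Φ.app C).map f ≫
      (Φ.iso v).hom.app y.fiber := rfl

variable (F X) in
/-- Composition with the structural pseudonatural transformation, as a functor from the category
of functors out of the filtered colimit to the category of pseudonatural transformations. -/
def restrict : (Obj F ⥤ X) ⥤ PseudoCocone F X where
  obj H :=
    { app := fun i => (cocone F).app i ⋙ H
      iso := fun f => Functor.isoWhiskerRight ((cocone F).iso f) H
      iso_id := fun i x => by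
        simp only [Functor.isoWhiskerRight_hom, Functor.whiskerRight_app, Functor.comp_map]
        rw [(cocone F).iso_id]
      iso_comp := fun f g x => by
        simp only [Functor.isoWhiskerRight_hom, Functor.whiskerRight_app, Functor.comp_map]
        rw [(cocone F).iso_comp, H.map_comp, H.map_comp] }
  map α :=
    { app := fun i => Functor.whiskerLeft ((cocone F).app i) α
      naturality := fun f x => α.naturality _ }

/-- Every morphism of the filtered colimit is a composite of structural morphisms. -/
lemma homMk_eq {x y : Obj F} {C : I} (u : x.base ⟶ C) (v : y.base ⟶ C)
    (f : (F.map u).toFunctor.obj x.fiber ⟶ (F.map v).toFunctor.obj y.fiber) :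
    (homMk u v f : x ⟶ y) = ((cocone F).iso u).inv.app x.fiber ≫ ((cocone F).app C).map f ≫
      ((cocone F).iso v).hom.app y.fiber := by
  have h := Functor.congr_hom congr($(F.map_id C).toFunctor) f
  have e₁ := comp_homMk_same (X := ⟨C, (F.map u).toFunctor.obj x.fiber⟩)
    (Y := ⟨C, (F.map v).toFunctor.obj y.fiber⟩) (Z := y) (𝟙 C) (𝟙 C) v
    ((F.map (𝟙 C)).toFunctor.map f) (eqToHom (by simp))
  have e₂ := comp_homMk_same (X := x) (Y := ⟨C, (F.map u).toFunctor.obj x.fiber⟩)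
    (Z := y) u (𝟙 C) v (eqToHom (by simp))
    ((F.map (𝟙 C)).toFunctor.map f ≫ eqToHom (by simp))
  rw [← e₁] at e₂
  refine Eq.trans ?_ e₂.symm
  congr 1
  simp [h]

lemma eqToHom_sandwich {a b : X} (f : a ⟶ b) (h : a = a) (h' : b = b) :
    f = eqToHom h ≫ f ≫ eqToHom h' := by simp

lemma map_homMk (L : Obj F ⥤ X) {x y : Obj F} {C : I} (u : x.base ⟶ C) (v : y.base ⟶ C)
    (f : (F.map u).toFunctor.obj x.fiber ⟶ (F.map v).toFunctor.obj y.fiber) :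
    L.map (homMk u v f : x ⟶ y) = L.map (((cocone F).iso u).inv.app x.fiber) ≫
      L.map (((cocone F).app C).map f) ≫ L.map (((cocone F).iso v).hom.app y.fiber) := by
  have map_comp₃ : ∀ {a b c d : Obj F} (f : a ⟶ b) (g : b ⟶ c) (h : c ⟶ d),
      L.map (f ≫ g ≫ h) = L.map f ≫ L.map g ≫ L.map h := by simp
  exact (congrArg L.map (homMk_eq u v f)).trans (map_comp₃ _ _ _)

lemma naturality_aux {a b c d a' b' c' d' : X} {ra : a ⟶ a'} {rb : b ⟶ b'} {rc : c ⟶ c'}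
    {rd : d ⟶ d'} {i : a ⟶ b} {j : b ⟶ a} {f : b ⟶ c} {v : c ⟶ d} {i' : a' ⟶ b'} {j' : b' ⟶ a'}
    {f' : b' ⟶ c'} {v' : c' ⟶ d'} (hij : i ≫ j = 𝟙 a) (hji : j' ≫ i' = 𝟙 b')
    (e₁ : j ≫ ra = rb ≫ j') (e₂ : f ≫ rc = rb ≫ f') (e₃ : v ≫ rd = rc ≫ v') :
    (i ≫ f ≫ v) ≫ rd = ra ≫ i' ≫ f' ≫ v' := by
  have : ra ≫ i' = i ≫ rb := by
    rw [← Category.id_comp ra, ← hij, Category.assoc, Category.assoc, reassoc_of% e₁, hji,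
      Category.comp_id]
  rw [reassoc_of% this, Category.assoc, Category.assoc, e₃, reassoc_of% e₂]

lemma desc_restrict (H : Obj F ⥤ X) : desc ((restrict F X).obj H) = H := by
  refine CategoryTheory.Functor.ext (fun _ => rfl) (fun x y f => ?_)
  obtain ⟨C, u, v, f, rfl⟩ := exists_rep f
  exact ((desc_homMk _ u v f).trans (map_homMk H u v f).symm).trans (eqToHom_sandwich _ rfl rfl)

lemma restrict_desc (Φ : PseudoCocone F X) : (restrict F X).obj (desc Φ) = Φ := by
  refine PseudoCocone.ext (fun i => CategoryTheory.Functor.ext (fun _ => rfl) (fun x y f => ?_))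
    (fun {i j} f x => ?_)
  · have e : (Φ.iso (𝟙 i)).inv.app x ≫ (Φ.app i).map ((F.map (𝟙 i)).toFunctor.map f) ≫
        (Φ.iso (𝟙 i)).hom.app y = (Φ.app i).map f := by
      have := (Φ.iso (𝟙 i)).hom.naturality f
      simp only [Functor.comp_map] at this
      rw [this, Iso.inv_hom_id_app_assoc]
    exact (desc_homMk Φ (x := ⟨i, x⟩) (y := ⟨i, y⟩) (𝟙 i) (𝟙 i) _).trans (e.trans (eqToHom_sandwich _ rfl rfl))
  · have e : (Φ.iso (𝟙 j)).inv.app ((F.map f).toFunctor.obj x) ≫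
        (Φ.app j).map (eqToHom (by simp)) ≫ (Φ.iso f).hom.app x = (Φ.iso f).hom.app x := by
      rw [← Φ.iso_id, Iso.inv_hom_id_app_assoc]
    exact (desc_homMk Φ (x := ⟨j, (F.map f).toFunctor.obj x⟩) (y := ⟨i, x⟩) (𝟙 j) f _).trans
      (e.trans (eqToHom_sandwich _ rfl rfl))

/-- The filtered colimit has the universal property of the (2-)filtered (bi)colimit: composition
with the structural transformation is an isomorphism of categories. -/
theorem restrict_isomorphism :
    (restrict F X).Full ∧ (restrict F X).Faithful ∧ Function.Bijective (restrict F X).obj := by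
  refine ⟨⟨fun {H K} r => ?_⟩, ⟨fun {H K α β} h => ?_⟩, ?_⟩
  · refine ⟨⟨fun x => (r.app x.base).app x.fiber, fun x y f => ?_⟩, rfl⟩
    obtain ⟨C, u, v, f, rfl⟩ := exists_rep f
    have e : ∀ (L : Obj F ⥤ X) {a b : Obj F} (i : a ≅ b), L.map i.hom ≫ L.map i.inv = 𝟙 _ := by
      simp
    have e' : ∀ (L : Obj F ⥤ X) {a b : Obj F} (i : a ≅ b), L.map i.inv ≫ L.map i.hom = 𝟙 _ := by
      simp
    rw [map_homMk H, map_homMk K]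
    exact naturality_aux (e' H (((cocone F).iso u).app x.fiber)) (e K (((cocone F).iso u).app x.fiber))
      (r.naturality u x.fiber) ((r.app C).naturality f) (r.naturality v y.fiber)
  · ext x
    exact congrArg (fun r : PseudoCocone.Modification _ _ => (r.app x.base).app x.fiber) h
  · exact ⟨Function.LeftInverse.injective (g := desc) desc_restrict,
      Function.RightInverse.surjective (g := desc) restrict_desc⟩

end UniversalProperty

end FilteredColim

namespace LinearSite

variable (k : Type w) [CommRing k]

/-- A linear sieve on `A`: a submodule of the representable module `C(-, A)`, that is, a
`k`-submodule `R(B)` of `C(B, A)` for each `B`, stable under precomposition. -/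
@[ext]
structure LinearSieve {C : Type u} [Category.{v} C] [Preadditive C] [Linear k C] (A : C) where
  arrows : ∀ B : C, Submodule k (B ⟶ A)
  precomp_mem : ∀ {B B' : C} (g : B' ⟶ B) {f : B ⟶ A}, f ∈ arrows B → g ≫ f ∈ arrows B'

section

variable {C : Type u} [Category.{v} C] [Preadditive C] [Linear k C]

namespace LinearSieve

variable {k}

/-- The representable module `C(-, A)` as a sieve on `A`. -/
def top (A : C) : LinearSieve k A where
  arrows _ := ⊤
  precomp_mem _ _ _ := trivial

/-- The pullback `g⁻¹R` of a sieve. -/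
def pullback {A A' : C} (g : A' ⟶ A) (R : LinearSieve k A) : LinearSieve k A' where
  arrows B := (R.arrows B).comap (Linear.rightComp k B g)
  precomp_mem h f hf := by
    simp only [Submodule.mem_comap, Linear.rightComp_apply] at hf ⊢
    rw [Category.assoc]
    exact R.precomp_mem h hf

lemma mem_pullback {A A' : C} (g : A' ⟶ A) (R : LinearSieve k A) {B : C} (f : B ⟶ A') :
    f ∈ (R.pullback g).arrows B ↔ f ≫ g ∈ R.arrows B := Iff.rfl

/-- The sieve generated by a family of morphisms `c i : Y i ⟶ A`. -/
def generate {A : C} {ι : Type*} {Y : ι → C} (c : ∀ i, Y i ⟶ A) : LinearSieve k A where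
  arrows B := Submodule.span k {f | ∃ (i : ι) (h : B ⟶ Y i), f = h ≫ c i}
  precomp_mem {B B'} g f hf := by
    induction hf using Submodule.span_induction with
    | mem f hf =>
      obtain ⟨i, h, rfl⟩ := hf
      exact Submodule.subset_span ⟨i, g ≫ h, by simp⟩
    | zero => simp
    | add f f' _ _ hf hf' => rw [Preadditive.comp_add]; exact add_mem hf hf'
    | smul c f _ hf => rw [Linear.comp_smul]; exact Submodule.smul_mem _ c hf

/-- `generate c` is the smallest sieve containing the family `c`. -/
lemma generate_le_iff {A : C} {ι : Type*} {Y : ι → C} (c : ∀ i, Y i ⟶ A) (R : LinearSieve k A) :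
    (∀ B, (generate (k := k) c).arrows B ≤ R.arrows B) ↔ ∀ i, c i ∈ R.arrows (Y i) := by
  constructor
  · intro h i
    exact h _ (Submodule.subset_span ⟨i, 𝟙 _, by simp⟩)
  · intro h B
    refine Submodule.span_le.2 ?_
    rintro f ⟨i, g, rfl⟩
    exact R.precomp_mem g (h i)

lemma mem_generate {A : C} {ι : Type*} {Y : ι → C} (c : ∀ i, Y i ⟶ A) (i : ι) :
    c i ∈ (generate (k := k) c).arrows (Y i) :=
  (generate_le_iff c _).1 (fun _ => le_rfl) i

end LinearSieve

/-- A `k`-linear Grothendieck topology: a cover system satisfying the identity, pullback and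
glueing axioms. -/
@[ext]
structure LinearTopology (C : Type u) [Category.{v} C] [Preadditive C] [Linear k C] where
  covers : ∀ A : C, Set (LinearSieve k A)
  top_mem : ∀ A : C, LinearSieve.top A ∈ covers A
  pullback_mem : ∀ {A A' : C} (g : A' ⟶ A) {R : LinearSieve k A}, R ∈ covers A →
    R.pullback g ∈ covers A'
  glue : ∀ {A : C} (R S : LinearSieve k A), S ∈ covers A →
    (∀ {A' : C} (g : A' ⟶ A), g ∈ S.arrows A' → R.pullback g ∈ covers A') → R ∈ covers A

variable {k}

lemma LinearTopology.superset_mem (T : LinearTopology k C) {A : C} {R S : LinearSieve k A}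
    (hS : S ∈ T.covers A) (h : ∀ B, S.arrows B ≤ R.arrows B) : R ∈ T.covers A := by
  refine T.glue R S hS (fun {A'} g hg => ?_)
  have : R.pullback g = LinearSieve.top A' := by
    ext B f
    simp only [LinearSieve.mem_pullback, LinearSieve.top, Submodule.mem_top, iff_true]
    exact R.precomp_mem f (h _ hg)
  rw [this]
  exact T.top_mem A'

/-- A family of morphisms is covering if the sieve it generates is a cover. -/
def LinearTopology.IsCovering (T : LinearTopology k C) {A : C} {ι : Type*} {Y : ι → C}
    (c : ∀ i, Y i ⟶ A) : Prop :=
  LinearSieve.generate c ∈ T.covers A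

/-- The sheaf condition for a presheaf `P` and a sieve `R` on `A`: each morphism of modules
`φ : R ⟶ P` extends uniquely along `R ⊆ C(-, A)`, that is, comes from a unique `x ∈ P(A)`. -/
def IsSheafFor (P : Cᵒᵖ ⥤ ModuleCat.{v} k) {A : C} (R : LinearSieve k A) : Prop :=
  ∀ φ : ∀ B : C, R.arrows B →ₗ[k] P.obj (Opposite.op B),
    (∀ {B B' : C} (g : B' ⟶ B) (f : R.arrows B),
      φ B' ⟨g ≫ f.1, R.precomp_mem g f.2⟩ = (P.map g.op).hom (φ B f)) →
    ∃! x : P.obj (Opposite.op A), ∀ (B : C) (f : R.arrows B), φ B f = (P.map f.1.op).hom x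

/-- Sheaves for a `k`-linear topology. -/
def LinearTopology.IsSheaf (T : LinearTopology k C) (P : Cᵒᵖ ⥤ ModuleCat.{v} k) : Prop :=
  ∀ (A : C) (R : LinearSieve k A), R ∈ T.covers A → IsSheafFor P R

/-- A topology is subcanonical if all representable presheaves are sheaves. -/
def LinearTopology.IsSubcanonical (T : LinearTopology k C) : Prop :=
  ∀ X : C, T.IsSheaf ((linearYoneda k C).obj X)

instance : PartialOrder (LinearTopology k C) where
  le T T' := ∀ A, T.covers A ⊆ T'.covers A
  le_refl _ _ := subset_rfl
  le_trans _ _ _ h h' A := (h A).trans (h' A)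
  le_antisymm _ _ h h' := LinearTopology.ext (funext fun A => (h A).antisymm (h' A))

lemma isSheafFor_yoneda_iff (X : C) {A : C} (R : LinearSieve k A) :
    IsSheafFor ((linearYoneda k C).obj X) R ↔
    ∀ φ : ∀ B : C, R.arrows B →ₗ[k] (B ⟶ X),
    (∀ {B B' : C} (g : B' ⟶ B) (f : R.arrows B),
      φ B' ⟨g ≫ f.1, R.precomp_mem g f.2⟩ = g ≫ (φ B f)) →
    ∃! x : A ⟶ X, ∀ (B : C) (f : R.arrows B), φ B f = f.1 ≫ x := Iff.rfl

lemma IsSheafFor.separated {X : C} {A : C} {R : LinearSieve k A}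
    (h : IsSheafFor ((linearYoneda k C).obj X) R) {x y : A ⟶ X}
    (hxy : ∀ (B : C) (f : B ⟶ A), f ∈ R.arrows B → f ≫ x = f ≫ y) : x = y := by
  rw [isSheafFor_yoneda_iff] at h
  refine (h (fun B => (Linear.rightComp k B x).comp (R.arrows B).subtype) (by simp)).unique
    (y₁ := x) (y₂ := y) (by simp) ?_
  intro B f
  simpa using hxy B f.1 f.2

lemma isSheafFor_of_cover {X A : C} (R S : LinearSieve k A)
    (hS : ∀ {B : C} (g : B ⟶ A), IsSheafFor ((linearYoneda k C).obj X) (S.pullback g))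
    (hR : ∀ {B : C} (f : B ⟶ A), f ∈ S.arrows B →
      IsSheafFor ((linearYoneda k C).obj X) (R.pullback f)) :
    IsSheafFor ((linearYoneda k C).obj X) R := by
  rw [isSheafFor_yoneda_iff]
  intro φ hφ
  have hφ' : ∀ {B B' : C} (g : B' ⟶ B) (f : B ⟶ A) (hf : f ∈ R.arrows B)
      (hf' : g ≫ f ∈ R.arrows B'), φ B' ⟨g ≫ f, hf'⟩ = g ≫ φ B ⟨f, hf⟩ :=
    fun g f hf _ => hφ g ⟨f, hf⟩
  have ex : ∀ (B : C) (f : S.arrows B), ∃ y : B ⟶ X, ∀ (B' : C) (h : B' ⟶ B)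
      (hh : h ≫ f.1 ∈ R.arrows B'), φ B' ⟨h ≫ f.1, hh⟩ = h ≫ y := by
    intro B f
    have := hR f.1 f.2
    rw [isSheafFor_yoneda_iff] at this
    obtain ⟨y, hy, -⟩ := this
      (fun B' => (φ B').comp ((Linear.rightComp k B' f.1).restrict (fun _ h => h)))
      (fun {B₁ B₂} g h => by
        refine Eq.trans ?_ (hφ' g (h.1 ≫ f.1) h.2 (by
          rw [← Category.assoc]; exact (R.pullback f.1).precomp_mem g h.2))
        refine congrArg (φ B₂) (Subtype.ext ?_)
        exact Category.assoc _ _ _)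
    exact ⟨y, fun B' h hh => hy B' ⟨h, hh⟩⟩
  choose y hy using ex
  have sep : ∀ {B : C} {f : B ⟶ A} (_ : f ∈ S.arrows B) {a b : B ⟶ X},
      (∀ (B' : C) (h : B' ⟶ B), h ≫ f ∈ R.arrows B' → h ≫ a = h ≫ b) → a = b :=
    fun hf _ _ H => (hR _ hf).separated H
  have ycomp : ∀ {B B' : C} (g : B' ⟶ B) (f : S.arrows B),
      y B' ⟨g ≫ f.1, S.precomp_mem g f.2⟩ = g ≫ y B f := by
    intro B B' g f
    refine sep (S.precomp_mem g f.2) (fun B'' h hh => ?_)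
    rw [← hy B' ⟨g ≫ f.1, S.precomp_mem g f.2⟩ B'' h hh]
    have := hy B f B'' (h ≫ g) (by simpa using hh)
    simpa using this
  let ψ : ∀ B, S.arrows B →ₗ[k] (B ⟶ X) := fun B =>
    { toFun := y B
      map_add' := fun f f' => by
        refine sep (f + f').2 (fun B₁ h hh => ?_)
        refine sep (S.precomp_mem h f.2) (fun B₂ g hg => ?_)
        have hg' : (g ≫ h) ≫ f.1 ∈ R.arrows B₂ := by simpa using hg
        have hgs : (g ≫ h) ≫ (f + f').1 ∈ R.arrows B₂ := by
          simpa using R.precomp_mem g hh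
        have hg'' : (g ≫ h) ≫ f'.1 ∈ R.arrows B₂ := by
          have := sub_mem hgs hg'
          simpa using this
        have e := hy B (f + f') B₂ (g ≫ h) hgs
        have e₁ := hy B f B₂ (g ≫ h) hg'
        have e₂ := hy B f' B₂ (g ≫ h) hg''
        rw [← Category.assoc, ← Category.assoc, ← e, Preadditive.comp_add, ← e₁, ← e₂, ← map_add]
        congr 1
        ext
        simp
      map_smul' := fun c f => by
        refine sep f.2 (fun B₁ h hh => ?_)
        have hs : h ≫ (c • f).1 ∈ R.arrows B₁ := by
          simpa using Submodule.smul_mem _ c hh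
        rw [← hy B (c • f) B₁ h hs, RingHom.id_apply, Linear.comp_smul, ← hy B f B₁ h hh, ← map_smul]
        congr 1
        ext
        simp }
  have id_pb : S.pullback (𝟙 A) = S := by ext; simp [LinearSieve.mem_pullback]
  have hS' := hS (𝟙 A)
  rw [id_pb] at hS'
  obtain ⟨x, hx, -⟩ := (isSheafFor_yoneda_iff X S).1 hS' ψ (fun g f => ycomp g f)
  refine ⟨x, ?_, ?_⟩
  · intro B r
    refine (hS r.1).separated (fun B' h hh => ?_)
    have e := hx B' ⟨h ≫ r.1, hh⟩
    have e' := hy B' ⟨h ≫ r.1, hh⟩ B' (𝟙 _) (by simpa using R.precomp_mem h r.2)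
    simp only [Category.id_comp] at e'
    rw [hφ' h r.1 r.2 (R.precomp_mem h r.2)] at e'
    rw [e', ← Category.assoc]
    exact e
  · intro z hz
    refine hS'.separated (fun B f hf => ?_)
    refine sep hf (fun B' h hh => ?_)
    have e := hz B' ⟨h ≫ f, hh⟩
    have e₁ := hy B ⟨f, hf⟩ B' h hh
    have e₂ : y B ⟨f, hf⟩ = f ≫ x := hx B ⟨f, hf⟩
    rw [← e₂, ← e₁, e, Category.assoc]

variable (k C) in
/-- The canonical topology: the sieves all of whose pullbacks satisfy the sheaf condition for all
representable presheaves. -/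
def canonicalTopology : LinearTopology k C where
  covers A := {R | ∀ (X : C) {B : C} (g : B ⟶ A),
    IsSheafFor ((linearYoneda k C).obj X) (R.pullback g)}
  top_mem A X B g := by
    rw [isSheafFor_yoneda_iff]
    intro φ hφ
    refine ⟨φ B ⟨𝟙 B, trivial⟩, fun B' f => ?_, fun y hy => ?_⟩
    · rw [← hφ]; congr; simp
    · simpa using (hy B ⟨𝟙 B, trivial⟩).symm
  pullback_mem g R hR X B h := by
    have : (R.pullback g).pullback h = R.pullback (h ≫ g) := by
      ext; simp [LinearSieve.mem_pullback]
    rw [this]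
    exact hR X (h ≫ g)
  glue := by
    intro A R S hS hR X A₀ g₀
    have pb : ∀ {B B' : C} (g : B ⟶ A) (h : B' ⟶ B) (Q : LinearSieve k A),
        (Q.pullback g).pullback h = Q.pullback (h ≫ g) := by
      intro B B' g h Q
      ext; simp [LinearSieve.mem_pullback]
    refine isSheafFor_of_cover (R.pullback g₀) (S.pullback g₀) (fun g => ?_) (fun {B} f hf => ?_)
    · rw [pb]; exact hS X _
    · have := hR (f ≫ g₀) hf X (𝟙 B)
      rw [pb, Category.id_comp] at this
      rw [pb]; exact this

/-- The canonical topology is the largest subcanonical topology. -/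
theorem canonicalTopology_isGreatest :
    IsGreatest {T : LinearTopology k C | T.IsSubcanonical} (canonicalTopology k C) := by
  constructor
  · intro X A R hR
    have : R.pullback (𝟙 A) = R := by ext; simp [LinearSieve.mem_pullback]
    exact this ▸ hR X (𝟙 A)
  · intro T hT A R hR X B g
    exact hT X B _ (T.pullback_mem g hR)

end

section LC

variable {C : Type u₁} [Category.{v₁} C] [Preadditive C] [Linear k C]
  {D : Type u₂} [Category.{v₂} D] [Preadditive D] [Linear k D]

variable {k}

/-- The sieve generated by the image of a sieve `R` under `F`. -/
def LinearSieve.map (F : C ⥤ D) {A : C} (R : LinearSieve k A) : LinearSieve k (F.obj A) :=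
  LinearSieve.generate (ι := Σ B : C, R.arrows B) (Y := fun f => F.obj f.1) fun f => F.map f.2.1

/-- LC morphisms of linear sites. The four conditions are (G), (F), (FF) and the equality of the
topology of `C` with the preimage of that of `D`; the latter consists of the sieves `R` such that
the sieve generated by `F(R)` is a cover. -/
structure IsLC (T : LinearTopology k C) (T' : LinearTopology k D) (F : C ⥤ D) : Prop where
  additive : F.Additive
  linear : F.Linear k
  generating : ∀ X : D, ∃ (ι : Type (max u₁ v₂)) (A : ι → C) (c : ∀ i, F.obj (A i) ⟶ X),
    T'.IsCovering c
  locally_full : ∀ {A A' : C} (c : F.obj A ⟶ F.obj A'),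
    ∃ (ι : Type (max u₁ v₁)) (B : ι → C) (a : ∀ i, B i ⟶ A) (f : ∀ i, B i ⟶ A'),
      T.IsCovering a ∧ ∀ i, F.map (a i) ≫ c = F.map (f i)
  locally_faithful : ∀ {A A' : C} (a : A ⟶ A'), F.map a = 0 →
    ∃ (ι : Type (max u₁ v₁)) (B : ι → C) (b : ∀ i, B i ⟶ A),
      T.IsCovering b ∧ ∀ i, b i ≫ a = 0
  mem_covers_iff : ∀ {A : C} (R : LinearSieve k A), R ∈ T.covers A ↔ R.map F ∈ T'.covers (F.obj A)

namespace LinearTopology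

lemma mem_of_isCovering (T : LinearTopology k C) {A : C} {ι : Type*} {Y : ι → C}
    {c : ∀ i, Y i ⟶ A} (hc : T.IsCovering c) {R : LinearSieve k A}
    (h : ∀ i, c i ∈ R.arrows (Y i)) : R ∈ T.covers A :=
  T.superset_mem hc ((LinearSieve.generate_le_iff c R).2 h)

lemma pullback_mem_of_mem (T : LinearTopology k C) {A B : C} {R : LinearSieve k A} {g : B ⟶ A}
    (hg : g ∈ R.arrows B) : R.pullback g ∈ T.covers B :=
  T.superset_mem (T.top_mem B) (fun _ h _ => R.precomp_mem h hg)

lemma isCovering_arrows (T : LinearTopology k C) {A : C} {R : LinearSieve k A}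
    (hR : R ∈ T.covers A) :
    T.IsCovering (fun f : (Σ B : C, R.arrows B) => f.2.1) :=
  T.superset_mem hR (fun B f hf => LinearSieve.mem_generate
    (fun f : (Σ B : C, R.arrows B) => f.2.1) ⟨B, f, hf⟩)

/-- A sieve is a cover if its pullbacks along a covering family are. -/
lemma mem_of_local (T : LinearTopology k C) {A : C} {ι : Type*} {Y : ι → C}
    {c : ∀ i, Y i ⟶ A} (hc : T.IsCovering c) {R : LinearSieve k A}
    (h : ∀ i, R.pullback (c i) ∈ T.covers (Y i)) : R ∈ T.covers A := by
  refine T.glue R _ hc (fun {B} g hg => ?_)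
  replace hg : g ∈ Submodule.span k {f | ∃ (i : ι) (h : B ⟶ Y i), f = h ≫ c i} := hg
  induction hg using Submodule.span_induction with
  | mem f hf =>
    obtain ⟨i, t, rfl⟩ := hf
    refine T.superset_mem (T.pullback_mem t (h i)) (fun X x hx => ?_)
    simpa [LinearSieve.mem_pullback] using hx
  | zero => exact T.pullback_mem_of_mem (zero_mem _)
  | add f f' _ _ hf hf' =>
    refine T.glue _ _ hf (fun {X} x hx => T.superset_mem (T.pullback_mem x hf') (fun Z z hz => ?_))
    have h₁ := R.precomp_mem z hx
    simp only [LinearSieve.mem_pullback, Category.assoc, Preadditive.comp_add] at h₁ hz ⊢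
    exact add_mem h₁ hz
  | smul a f _ hf =>
    refine T.superset_mem hf (fun Z z hz => ?_)
    simp only [LinearSieve.mem_pullback, Linear.comp_smul] at hz ⊢
    exact Submodule.smul_mem _ a hz

end LinearTopology

lemma LinearSieve.map_mem (F : C ⥤ D) {A B : C} (R : LinearSieve k A) {f : B ⟶ A}
    (hf : f ∈ R.arrows B) : F.map f ∈ (R.map F).arrows (F.obj B) :=
  LinearSieve.mem_generate (ι := Σ B : C, R.arrows B) (Y := fun f => F.obj f.1)
    (fun f => F.map f.2.1) ⟨B, f, hf⟩

lemma LinearSieve.map_le_iff (F : C ⥤ D) {A : C} (R : LinearSieve k A)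
    (S : LinearSieve k (F.obj A)) : (∀ X, (R.map F).arrows X ≤ S.arrows X) ↔
      ∀ (B : C) (f : B ⟶ A), f ∈ R.arrows B → F.map f ∈ S.arrows (F.obj B) :=
  (LinearSieve.generate_le_iff _ _).trans
    ⟨fun h B f hf => h ⟨B, f, hf⟩, fun h f => h f.1 f.2.1 f.2.2⟩

/-- The sieve of all `a` with `F(a) ∈ R`. -/
def LinearSieve.comap (F : C ⥤ D) [F.Additive] [F.Linear k] {A : C}
    (R : LinearSieve k (F.obj A)) : LinearSieve k A where
  arrows B := (R.arrows (F.obj B)).comap (F.mapLinearMap k)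
  precomp_mem g f hf := by
    change F.map (g ≫ f) ∈ R.arrows _
    rw [F.map_comp]
    exact R.precomp_mem _ hf

lemma LinearSieve.mem_comap (F : C ⥤ D) [F.Additive] [F.Linear k] {A B : C}
    (R : LinearSieve k (F.obj A)) (f : B ⟶ A) :
    f ∈ (R.comap F).arrows B ↔ F.map f ∈ R.arrows (F.obj B) := Iff.rfl

namespace IsLC

variable {T : LinearTopology k C} {T' : LinearTopology k D}

lemma map_isCovering {F : C ⥤ D} (h : IsLC T T' F) {A : C} {ι : Type*} {Y : ι → C}
    {c : ∀ i, Y i ⟶ A} (hc : T.IsCovering c) : T'.IsCovering (fun i => F.map (c i)) := by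
  have := h.additive
  have := h.linear
  refine T'.superset_mem ((h.mem_covers_iff _).1 hc) ((LinearSieve.map_le_iff F _ _).2 ?_)
  refine fun B f hf => (LinearSieve.generate_le_iff c
    ((LinearSieve.generate fun i => F.map (c i)).comap F)).2 (fun i => ?_) B hf
  exact LinearSieve.mem_generate (fun i => F.map (c i)) i

lemma comap_mem {F : C ⥤ D} [F.Additive] [F.Linear k] (h : IsLC T T' F) {A : C}
    {R : LinearSieve k (F.obj A)} (hR : R ∈ T'.covers (F.obj A)) : R.comap F ∈ T.covers A := by
  rw [h.mem_covers_iff]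
  refine T'.glue _ R hR (fun {X} g hg => ?_)
  obtain ⟨ι, Y, c, hc⟩ := h.generating X
  refine T'.mem_of_local hc (fun i => ?_)
  obtain ⟨J, B, a, f, ha, hf⟩ := h.locally_full (c i ≫ g)
  refine T'.mem_of_local (h.map_isCovering ha) (fun j => ?_)
  refine T'.pullback_mem_of_mem ?_
  have h₁ : F.map (f j) ∈ R.arrows _ := by
    rw [← hf]
    exact R.precomp_mem _ (R.precomp_mem _ hg)
  have := LinearSieve.map_mem F (R.comap F) (f := f j) h₁
  rw [← hf] at this
  simpa [LinearSieve.mem_pullback] using this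

/-- The identity of a linear site is an LC morphism. -/
theorem id (T : LinearTopology k C) : IsLC T T (𝟭 C) where
  additive := inferInstance
  linear := inferInstance
  generating X := ⟨PUnit, fun _ => X, fun _ => 𝟙 X,
    T.superset_mem (T.top_mem X) (fun B f _ => by
      have := (LinearSieve.generate (k := k) (fun _ : PUnit => 𝟙 X)).precomp_mem f
        (LinearSieve.mem_generate _ PUnit.unit)
      simpa using this)⟩
  locally_full {A A'} c := ⟨PUnit, fun _ => A, fun _ => 𝟙 A, fun _ => c,
    T.superset_mem (T.top_mem A) (fun B f _ => by
      have := (LinearSieve.generate (k := k) (fun _ : PUnit => 𝟙 A)).precomp_mem f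
        (LinearSieve.mem_generate _ PUnit.unit)
      simpa using this), by simp⟩
  locally_faithful {A A'} a ha := ⟨PUnit, fun _ => A, fun _ => 𝟙 A,
    T.superset_mem (T.top_mem A) (fun B f _ => by
      have := (LinearSieve.generate (k := k) (fun _ : PUnit => 𝟙 A)).precomp_mem f
        (LinearSieve.mem_generate _ PUnit.unit)
      simpa using this), by simpa using ha⟩
  mem_covers_iff {A} R :=
    ⟨fun h => T.superset_mem h (fun _ _ hf => LinearSieve.map_mem (𝟭 C) R hf),
      fun h => T.superset_mem h ((LinearSieve.map_le_iff (𝟭 C) R R).2 fun _ _ hf => hf)⟩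

variable {E : Type u₃} [Category.{v₃} E] [Preadditive E] [Linear k E] {T'' : LinearTopology k E}

/-- LC morphisms are closed under composition. -/
theorem comp {F : C ⥤ D} {G : D ⥤ E} (h : IsLC T T' F) (h' : IsLC T' T'' G) :
    IsLC T T'' (F ⋙ G) := by
  have := h.additive
  have := h.linear
  have := h'.additive
  have := h'.linear
  refine ⟨inferInstance, inferInstance, fun X => ?_, fun {A A'} c => ?_, fun {A A'} a ha => ?_,
    fun {A} R => ?_⟩
  · refine ⟨Σ A : C, (F ⋙ G).obj A ⟶ X, fun a => a.1, fun a => a.2, ?_⟩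
    obtain ⟨ι, Y, c, hc⟩ := h'.generating X
    refine T''.mem_of_local hc (fun i => ?_)
    obtain ⟨J, Z, d, hd⟩ := h.generating (Y i)
    refine T''.mem_of_isCovering (h'.map_isCovering hd) (fun j => ?_)
    exact LinearSieve.mem_generate (ι := Σ A : C, (F ⋙ G).obj A ⟶ X)
      (Y := fun a => (F ⋙ G).obj a.1) (fun a => a.2) ⟨Z j, G.map (d j) ≫ c i⟩
  · let Q : LinearSieve k A :=
      { arrows := fun B => (LinearMap.range ((F ⋙ G).mapLinearMap k (X := B) (Y := A'))).comap
          ((Linear.rightComp k _ c).comp ((F ⋙ G).mapLinearMap k))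
        precomp_mem := by
          rintro B B' g f ⟨m, hm⟩
          refine ⟨g ≫ m, ?_⟩
          replace hm : (F ⋙ G).map m = (F ⋙ G).map f ≫ c := hm
          change (F ⋙ G).map (g ≫ m) = (F ⋙ G).map (g ≫ f) ≫ c
          rw [Functor.map_comp, Functor.map_comp, hm, Category.assoc] }
    have hQ : ∀ {B : C} (a : B ⟶ A) (m : B ⟶ A'),
        (F ⋙ G).map a ≫ c = (F ⋙ G).map m → a ∈ Q.arrows B := fun a m e => ⟨m, e.symm⟩
    have hQ' : ∀ {B : C} (a : B ⟶ A), a ∈ Q.arrows B →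
        ∃ m : B ⟶ A', (F ⋙ G).map a ≫ c = (F ⋙ G).map m := fun a ⟨m, e⟩ => ⟨m, e.symm⟩
    have cover : Q ∈ T.covers A := by
      obtain ⟨ι, Y, b, t, hb, ht⟩ := h'.locally_full (A := F.obj A) (A' := F.obj A') c
      let R : LinearSieve k (F.obj A) :=
        { arrows := fun B => (LinearMap.range (G.mapLinearMap k (X := B) (Y := F.obj A'))).comap
            ((Linear.rightComp k _ c).comp (G.mapLinearMap k))
          precomp_mem := by
            rintro B B' g f ⟨m, hm⟩
            refine ⟨g ≫ m, ?_⟩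
            replace hm : G.map m = G.map f ≫ c := hm
            change G.map (g ≫ m) = G.map (g ≫ f) ≫ c
            rw [Functor.map_comp, Functor.map_comp, hm, Category.assoc] }
      have hR : R ∈ T'.covers _ := T'.mem_of_isCovering hb (fun i => ⟨t i, (ht i).symm⟩)
      refine T.glue Q _ (h.comap_mem hR) (fun {B} g hg => ?_)
      obtain ⟨m, hm⟩ := hg
      have hm : G.map m = G.map (F.map g) ≫ c := hm
      obtain ⟨J, Z, e, n, he, hn⟩ := h.locally_full m
      refine T.mem_of_isCovering he (fun j => hQ _ (n j) ?_)
      simp [← hn, ← hm]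
    refine ⟨Σ B : C, Q.arrows B, fun a => a.1, fun a => a.2.1, fun a => (hQ' a.2.1 a.2.2).choose,
      T.isCovering_arrows cover, fun a => (hQ' a.2.1 a.2.2).choose_spec⟩
  · let Q : LinearSieve k A :=
      { arrows := fun B => LinearMap.ker (Linear.rightComp k B a)
        precomp_mem := fun g f hf => by
          simp only [LinearMap.mem_ker, Linear.rightComp_apply, Category.assoc] at hf ⊢
          rw [hf, Limits.comp_zero] }
    have cover : Q ∈ T.covers A := by
      obtain ⟨ι, Y, b, hb, hb'⟩ := h'.locally_faithful (F.map a) ha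
      let R : LinearSieve k (F.obj A) :=
        { arrows := fun B => LinearMap.ker (Linear.rightComp k B (F.map a))
          precomp_mem := fun g f hf => by
            simp only [LinearMap.mem_ker, Linear.rightComp_apply, Category.assoc] at hf ⊢
            rw [hf, Limits.comp_zero] }
      have hR : R ∈ T'.covers _ := T'.mem_of_isCovering hb (fun i => hb' i)
      refine T.glue Q _ (h.comap_mem hR) (fun {B} g hg => ?_)
      have hg : F.map g ≫ F.map a = 0 := hg
      obtain ⟨J, Z, e, he, he'⟩ := h.locally_faithful (g ≫ a) (by rw [F.map_comp, hg])
      refine T.mem_of_isCovering he (fun j => ?_)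
      exact (Category.assoc _ _ _).trans (he' j)
    exact ⟨Σ B : C, Q.arrows B, fun a => a.1, fun a => a.2.1, T.isCovering_arrows cover,
      fun a => a.2.2⟩
  · rw [h.mem_covers_iff, h'.mem_covers_iff]
    constructor
    · intro H
      refine T''.superset_mem H ((LinearSieve.map_le_iff G _ _).2 fun B f hf => ?_)
      refine (LinearSieve.map_le_iff F R ((R.map (F ⋙ G)).comap G (A := F.obj A))).2 ?_ B hf
      exact fun B' f' hf' => LinearSieve.map_mem (F ⋙ G) R hf'
    · intro H
      refine T''.superset_mem H ((LinearSieve.map_le_iff (F ⋙ G) _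
        ((R.map F).map G)).2 fun B f hf => ?_)
      exact LinearSieve.map_mem G _ (LinearSieve.map_mem F R hf)

end IsLC

end LC

section SitePresentations

variable (C : Type u) [Category.{v} C] [Preadditive C] [Linear k C]

/-- Objects of `J_C`: LC morphisms from small `k`-linear sites to `C`, where `C` carries its
canonical topology. -/
structure SitePresentation where
  carrier : Type v
  [category : Category.{v} carrier]
  [preadditive : Preadditive carrier]
  [linear : Linear k carrier]
  topology : LinearTopology k carrier
  functor : carrier ⥤ C
  isLC : IsLC topology (canonicalTopology k C) functor

attribute [instance] SitePresentation.category SitePresentation.preadditive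
  SitePresentation.linear

namespace SitePresentation

variable {k C}

/-- Morphisms of `J_C`: LC morphisms between the domains which commute strictly with the functors
to `C`. -/
@[ext]
structure Hom (a b : SitePresentation k C) where
  functor : a.carrier ⥤ b.carrier
  isLC : IsLC a.topology b.topology functor
  w : functor ⋙ b.functor = a.functor

instance : Category (SitePresentation k C) where
  Hom := Hom
  id a := ⟨𝟭 _, IsLC.id _, rfl⟩
  comp f g := ⟨f.functor ⋙ g.functor, f.isLC.comp g.isLC, by
    rw [Functor.assoc, g.w, f.w]⟩

end SitePresentation

/-- The functor `G_C : J_C ⥤ Cat` sending an LC morphism to its domain. -/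
def domain : SitePresentation k C ⥤ Cat.{v, v} where
  obj a := Cat.of a.carrier
  map f := f.functor.toCatHom

instance (a : SitePresentation k C) : Preadditive ((domain k C).obj a) :=
  inferInstanceAs (Preadditive a.carrier)

instance (a : SitePresentation k C) : Linear k ((domain k C).obj a) :=
  inferInstanceAs (Linear k a.carrier)

instance {a b : SitePresentation k C} (f : a ⟶ b) :
    ((domain k C).map f).toFunctor.Additive :=
  f.isLC.additive

instance {a b : SitePresentation k C} (f : a ⟶ b) :
    ((domain k C).map f).toFunctor.Linear k :=
  f.isLC.linear

lemma eqToHom_comp₃ {C : Type u} [Category.{v} C] {a b c d : C} {p : a ⟶ b} {q : b ⟶ c}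
    {r : c ⟶ d} {s : a ⟶ d} (hp : ∃ h, p = eqToHom h) (hq : ∃ h, q = eqToHom h)
    (hr : ∃ h, r = eqToHom h) (hs : ∃ h, s = eqToHom h) : s = p ≫ q ≫ r := by
  obtain ⟨h₁, rfl⟩ := hp
  obtain ⟨h₂, rfl⟩ := hq
  obtain ⟨h₃, rfl⟩ := hr
  obtain ⟨h₄, rfl⟩ := hs
  simp

/-- The tautological (strict) cocone on `G_C` with vertex `C`, given by the LC morphisms. -/
def tautologicalCocone : FilteredColim.PseudoCocone (domain k C) C where
  app a := a.functor
  iso f := eqToIso f.w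
  iso_id a x := (eqToHom_app (SitePresentation.Hom.w (𝟙 a)) x).trans
    (eqToHom_map a.functor _).symm
  iso_comp {a b c} f g x := eqToHom_comp₃ ⟨_, eqToHom_map c.functor _⟩ ⟨_, eqToHom_app g.w _⟩
    ⟨_, eqToHom_app f.w x⟩ ⟨_, eqToHom_app (f ≫ g).w x⟩

/-- The comparison functor from the filtered colimit of `G_C` to `C`: it sends `(x, u)` to `u(x)`
and the class of `(u, f, v)`, for `f` a morphism in the domain of `u_c`, to `u_c(f)`. -/
def comparison [IsFiltered (SitePresentation k C)] : FilteredColim.Obj (domain k C) ⥤ C :=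
  FilteredColim.desc (tautologicalCocone k C)

lemma comparison_obj [IsFiltered (SitePresentation k C)] (x : FilteredColim.Obj (domain k C)) :
    (comparison k C).obj x = x.base.functor.obj x.fiber := rfl

lemma comparison_map [IsFiltered (SitePresentation k C)] {x y : FilteredColim.Obj (domain k C)}
    {c : SitePresentation k C} (u : x.base ⟶ c) (v : y.base ⟶ c)
    (f : u.functor.obj x.fiber ⟶ v.functor.obj y.fiber) :
    (comparison k C).map (FilteredColim.homMk u v f : x ⟶ y) =
      eqToHom (Functor.congr_obj u.w x.fiber).symm ≫ c.functor.map f ≫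
        eqToHom (Functor.congr_obj v.w y.fiber) := by
  refine (FilteredColim.desc_homMk (tautologicalCocone k C) u v f).trans ?_
  change (eqToIso u.w).inv.app x.fiber ≫ c.functor.map f ≫ (eqToIso v.w).hom.app y.fiber = _
  rw [eqToIso.inv, eqToIso.hom]
  exact congrArg₂ (· ≫ c.functor.map f ≫ ·) (eqToHom_app u.w.symm x.fiber)
    (eqToHom_app v.w y.fiber)

end SitePresentations

end LinearSite

end

/-!
The proof rests on the small full subcategories of `C` whose objects generate `C` for the canonical
topology. With the induced topology, the inclusion of such a subcategory is an LC morphism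
(`LinearSite.IsGenerating.isLC_inducedTopology`). These inclusions, the *full* site presentations,
control all of `J_C`:

* LC morphisms cancel along a fully faithful LC morphism (`LinearSite.IsLC.of_comp`). Hence a site
  presentation maps to a full one as soon as its values lie in the subcategory, and such a map is
  unique, because the inclusion is faithful and injective on objects
  (`LinearSite.SitePresentation.IsFull.exists_hom`, `LinearSite.SitePresentation.IsFull.hom_ext`).
* For site presentations `a` and `b`, the union of their sets of values spans a full site
  presentation to which both map (`LinearSite.SitePresentation.exists_isFull`). With uniqueness,
  this gives cocones on pairs of objects and on pairs of parallel morphisms, so `J_C` is filtered.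

The comparison functor is full, since morphisms of `C` lift to a full site presentation receiving
both objects, and faithful, since representatives can be pushed to a full site presentation, where
they are determined by their images in `C`.

The only place where `C` has to be a Grothendieck category is the existence of full site
presentations, with a prescribed object among their values: if `G` is a separator, then each sieve
containing all morphisms from `G` is a cover for the canonical topology
(`LinearSite.mem_canonicalTopology_of_isSeparator`). By the Gabriel-Popescu theorem
`C(G, -)` is fully faithful as a functor to `End G`-modules, and the restriction of a compatible
family to the morphisms from `G` is precisely an `End G`-linear map.
-/

noncomputable section

namespace LinearSite

/-! ### Sieves and fully faithful functors -/

section FullyFaithful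

variable {k : Type w} [CommRing k] {C : Type u₁} [Category.{v₁} C] [Preadditive C] [Linear k C]
  {D : Type u₂} [Category.{v₂} D] [Preadditive D] [Linear k D]
  {E : Type u₃} [Category.{v₃} E] [Preadditive E] [Linear k E]

lemma LinearSieve.map_map (F : C ⥤ D) (G : D ⥤ E) [F.Additive] [F.Linear k] [G.Additive]
    [G.Linear k] {A : C} (R : LinearSieve k A) : (R.map F).map G = R.map (F ⋙ G) := by
  refine LinearSieve.ext (funext fun X => le_antisymm ?_ ?_)
  · refine (LinearSieve.map_le_iff G (R.map F) (R.map (F ⋙ G))).2 ?_ X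
    exact (LinearSieve.map_le_iff F R ((R.map (F ⋙ G)).comap G (A := F.obj A))).2
      fun B f hf => LinearSieve.map_mem (F ⋙ G) R hf
  · exact (LinearSieve.map_le_iff (F ⋙ G) R ((R.map F).map G)).2
      (fun B f hf => LinearSieve.map_mem G _ (LinearSieve.map_mem F R hf)) X

/-- Taking the generated sieve along a fully faithful functor adds no arrows between objects in
the image. -/
lemma LinearSieve.map_mem_map_iff (F : C ⥤ D) [F.Additive] [F.Linear k] [F.Full] [F.Faithful]
    {A B : C} (R : LinearSieve k A) (f : B ⟶ A) :
    F.map f ∈ (R.map F).arrows (F.obj B) ↔ f ∈ R.arrows B := by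
  refine ⟨fun hf => ?_, LinearSieve.map_mem F R⟩
  suffices H : (R.map F).arrows (F.obj B) ≤ (R.arrows B).map (F.mapLinearMap k) by
    obtain ⟨g, hg, e⟩ := H hf
    rwa [← F.map_injective e]
  refine Submodule.span_le.2 ?_
  rintro _ ⟨⟨B', r⟩, h, rfl⟩
  exact ⟨F.preimage h ≫ r.1, R.precomp_mem _ r.2, by simp⟩

/-- The images of the objects under `F` generate for `T'`: this is condition (G). -/
def IsGenerating (T' : LinearTopology k D) (F : C ⥤ D) : Prop :=
  ∀ X : D, T'.IsCovering (fun c : (Σ A : C, F.obj A ⟶ X) => c.2)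

lemma IsLC.isGenerating {T : LinearTopology k C} {T' : LinearTopology k D} {F : C ⥤ D}
    (h : IsLC T T' F) : IsGenerating T' F := fun X => by
  obtain ⟨ι, A, c, hc⟩ := h.generating X
  exact T'.mem_of_isCovering hc fun i =>
    LinearSieve.mem_generate (fun c : (Σ A : C, F.obj A ⟶ X) => c.2) ⟨A i, c i⟩

/-- Being a cover only depends on the arrows out of the objects of a generating family. -/
lemma IsGenerating.mem_covers {T' : LinearTopology k D} {F : C ⥤ D} (h : IsGenerating T' F)
    {X : D} {S Q : LinearSieve k X} (hS : S ∈ T'.covers X)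
    (hQ : ∀ (B : C) (m : F.obj B ⟶ X), m ∈ S.arrows _ → m ∈ Q.arrows _) :
    Q ∈ T'.covers X :=
  T'.glue Q S hS fun {Y} g hg => T'.mem_of_isCovering (h Y) fun c =>
    hQ c.1 (c.2 ≫ g) (S.precomp_mem c.2 hg)

/-- The topology induced by a fully faithful functor whose image generates: a sieve is a cover if
its image generates a cover. -/
def IsGenerating.inducedTopology {T' : LinearTopology k D} {F : C ⥤ D} [F.Additive] [F.Linear k]
    [F.Full] [F.Faithful] (h : IsGenerating T' F) : LinearTopology k C where
  covers A := {R | R.map F ∈ T'.covers (F.obj A)}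
  top_mem A := h.mem_covers (T'.top_mem _) fun B m _ => by
    rw [← F.map_preimage m, LinearSieve.map_mem_map_iff]
    trivial
  pullback_mem {A A'} g R hR := by
    refine h.mem_covers (T'.pullback_mem (F.map g) hR) fun B m hm => ?_
    obtain ⟨m, rfl⟩ := F.map_surjective m
    rw [LinearSieve.mem_pullback, ← F.map_comp, LinearSieve.map_mem_map_iff] at hm
    rwa [LinearSieve.map_mem_map_iff]
  glue R S hS hR := by
    refine T'.mem_of_local hS fun f => T'.superset_mem (hR f.2.1 f.2.2)
      ((LinearSieve.map_le_iff F _ _).2 fun B g hg => ?_)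
    rw [LinearSieve.mem_pullback, ← F.map_comp, LinearSieve.map_mem_map_iff]
    exact hg

/-- Conditions (F) and (FF) hold for trivial reasons: the covering family can be taken to consist
of all morphisms to `A`. -/
theorem IsGenerating.isLC_inducedTopology {T' : LinearTopology k D} {F : C ⥤ D} [F.Additive]
    [F.Linear k] [F.Full] [F.Faithful] (h : IsGenerating T' F) :
    IsLC h.inducedTopology T' F where
  additive := inferInstance
  linear := inferInstance
  generating X := ⟨Σ A : C, F.obj A ⟶ X, fun c => c.1, fun c => c.2, h X⟩
  locally_full {A A'} c := ⟨Σ B : C, (LinearSieve.top (k := k) A).arrows B, fun f => f.1,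
    fun f => f.2.1, fun f => f.2.1 ≫ F.preimage c,
    LinearTopology.isCovering_arrows _ (LinearTopology.top_mem _ A), fun f => by simp⟩
  locally_faithful {A A'} a ha := ⟨Σ B : C, (LinearSieve.top (k := k) A).arrows B, fun f => f.1,
    fun f => f.2.1, LinearTopology.isCovering_arrows _ (LinearTopology.top_mem _ A), fun f => by
      rw [F.map_injective (ha.trans (F.map_zero _ _).symm)]
      exact Limits.comp_zero⟩
  mem_covers_iff _ := Iff.rfl

/-- LC morphisms can be cancelled along a fully faithful LC morphism `G`: sieves and covers are
detected by `G`, and morphisms can be lifted along it. -/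
theorem IsLC.of_comp {T : LinearTopology k C} {T' : LinearTopology k D} {T'' : LinearTopology k E}
    {F : C ⥤ D} {G : D ⥤ E} [G.Full] [G.Faithful] (h : IsLC T T'' (F ⋙ G)) (h' : IsLC T' T'' G) :
    IsLC T T' F := by
  have := h.additive
  have := h.linear
  have := h'.additive
  have := h'.linear
  have hF : F.Additive := ⟨fun {X Y f g} => G.map_injective (by
    rw [G.map_add]; exact (F ⋙ G).map_add)⟩
  have hF' : F.Linear k := ⟨fun f c => G.map_injective (by
    rw [G.map_smul]; exact (F ⋙ G).map_smul c f)⟩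
  refine ⟨hF, hF', fun X => ?_, fun {A A'} c => ?_, fun {A A'} a ha => ?_, fun {A} R => ?_⟩
  · refine ⟨Σ A : C, F.obj A ⟶ X, fun c => c.1, fun c => c.2, (h'.mem_covers_iff _).2 ?_⟩
    refine T''.mem_of_isCovering (h.isGenerating (G.obj X)) fun c => ?_
    rw [← G.map_preimage (X := F.obj c.1) c.2]
    exact LinearSieve.map_mem G _ (LinearSieve.mem_generate
      (fun c : (Σ A : C, F.obj A ⟶ X) => c.2) ⟨c.1, G.preimage c.2⟩)
  · obtain ⟨ι, B, a, f, ha, hf⟩ := h.locally_full (A := A) (A' := A') (G.map c)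
    exact ⟨ι, B, a, f, ha, fun i => G.map_injective ((G.map_comp _ _).trans (hf i))⟩
  · exact h.locally_faithful a ((congrArg G.map ha).trans (G.map_zero _ _))
  · rw [h.mem_covers_iff, h'.mem_covers_iff, LinearSieve.map_map]
    rfl

end FullyFaithful

/-! ### Generating families for the canonical topology -/

section Grothendieck

variable {k : Type w} [CommRing k] {C : Type u} [Category.{v} C] [Abelian C] [Linear k C]
  [IsGrothendieckAbelian.{v} C]

/-- A sieve that contains all morphisms from a separator `G` satisfies the sheaf condition for
representable presheaves. The values on morphisms from `G` of a morphism of modules into `C(-, X)`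
form an `End G`-linear map `C(G, A) ⟶ C(G, X)`, which comes from a unique `A ⟶ X` because
`C(G, -)` is fully faithful by the Gabriel-Popescu theorem. -/
lemma isSheafFor_of_isSeparator {G : C} (hG : IsSeparator G) (X : C) {A : C}
    {R : LinearSieve k A} (hR : R.arrows G = ⊤) :
    IsSheafFor ((linearYoneda k C).obj X) R := by
  rw [isSheafFor_yoneda_iff]
  intro φ hφ
  have hm : ∀ f : G ⟶ A, f ∈ R.arrows G := fun f => hR ▸ Submodule.mem_top
  have := IsGrothendieckAbelian.GabrielPopescu.full G hG
  let ψ : (preadditiveCoyonedaObj G).obj A ⟶ (preadditiveCoyonedaObj G).obj X := ModuleCat.ofHom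
    { toFun := fun f : G ⟶ A => φ G ⟨f, hm f⟩
      map_add' := fun f g => (φ G).map_add ⟨f, hm f⟩ ⟨g, hm g⟩
      map_smul' := fun r f => hφ r.unop ⟨f, hm f⟩ }
  obtain ⟨x, hx⟩ := (preadditiveCoyonedaObj G).map_surjective ψ
  have hx' : ∀ f : G ⟶ A, f ≫ x = φ G ⟨f, hm f⟩ := fun f => congr($(hx).hom f)
  refine ⟨x, fun B f => ?_, fun y hy => ?_⟩
  · refine hG.def _ _ fun g => ?_
    rw [← hφ g f, ← Category.assoc, hx']
  · refine hG.def _ _ fun g => ?_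
    rw [hx', ← hy G ⟨g, hm g⟩]

lemma mem_canonicalTopology_of_isSeparator {G : C} (hG : IsSeparator G) {A : C}
    {R : LinearSieve k A} (hR : ∀ f : G ⟶ A, f ∈ R.arrows G) :
    R ∈ (canonicalTopology k C).covers A := fun X _ g =>
  isSheafFor_of_isSeparator hG X (eq_top_iff.2 fun f _ => hR (f ≫ g))

end Grothendieck

namespace SitePresentation

variable {k : Type w} [CommRing k] {C : Type u} [Category.{v} C] [Preadditive C] [Linear k C]

/-! ### Small full subcategories as site presentations -/

/-- A `v`-small model of the full subcategory of `C` on a small set `S` of objects. Distinct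
objects of the model are distinct in `C`. -/
abbrev FullModel (S : Set C) [Small.{v} S] : Type v :=
  InducedCategory C fun s : Shrink.{v} S => ((equivShrink S).symm s : C)

/-- The inclusion of the full subcategory on `S`. -/
abbrev FullModel.incl (S : Set C) [Small.{v} S] : FullModel S ⥤ C := inducedFunctor _

lemma FullModel.incl_obj_injective (S : Set C) [Small.{v} S] :
    Function.Injective (FullModel.incl S).obj :=
  Subtype.val_injective.comp (equivShrink S).symm.injective

lemma FullModel.exists_obj {S : Set C} [Small.{v} S] {X : C} (hX : X ∈ S) :
    ∃ s, (FullModel.incl S).obj s = X :=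
  ⟨equivShrink S ⟨X, hX⟩, congrArg Subtype.val ((equivShrink S).symm_apply_apply ⟨X, hX⟩)⟩

/-- The site presentation given by a small full subcategory that generates `C`. -/
def ofSet (S : Set C) [Small.{v} S]
    (h : IsGenerating (canonicalTopology k C) (FullModel.incl S)) : SitePresentation k C where
  carrier := FullModel S
  topology := h.inducedTopology
  functor := FullModel.incl S
  isLC := h.isLC_inducedTopology

/-- A site presentation is full if it is the inclusion of a full subcategory: it is fully faithful
and injective on objects. -/
structure IsFull (c : SitePresentation k C) : Prop where
  full : c.functor.Full
  faithful : c.functor.Faithful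
  obj_injective : Function.Injective c.functor.obj

lemma isFull_ofSet (S : Set C) [Small.{v} S]
    (h : IsGenerating (canonicalTopology k C) (FullModel.incl S)) : (ofSet S h).IsFull :=
  ⟨inferInstanceAs (FullModel.incl S).Full, inferInstanceAs (FullModel.incl S).Faithful,
    FullModel.incl_obj_injective S⟩

lemma FullModel.mem_generate {S : Set C} [Small.{v} S] {A X : C} (hA : A ∈ S) (f : A ⟶ X) :
    f ∈ (LinearSieve.generate (k := k)
      (fun c : (Σ s : FullModel S, (FullModel.incl S).obj s ⟶ X) => c.2)).arrows A := by
  obtain ⟨s, rfl⟩ := FullModel.exists_obj hA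
  exact LinearSieve.mem_generate
    (fun c : (Σ s : FullModel S, (FullModel.incl S).obj s ⟶ X) => c.2) ⟨s, f⟩

/-- A set containing all values of an LC morphism generates. -/
lemma isGenerating_incl (a : SitePresentation k C) (S : Set C) [Small.{v} S]
    (hS : Set.range a.functor.obj ⊆ S) :
    IsGenerating (canonicalTopology k C) (FullModel.incl S) := fun X =>
  (canonicalTopology k C).mem_of_isCovering (a.isLC.isGenerating X) fun c =>
    FullModel.mem_generate (hS ⟨c.1, rfl⟩) c.2

/-- A functor into `C` all of whose values lie in the image of a full site presentation lifts
strictly to the latter. -/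
lemma IsFull.exists_hom {a c : SitePresentation k C} (hc : c.IsFull)
    (h : Set.range a.functor.obj ⊆ Set.range c.functor.obj) : Nonempty (a ⟶ c) := by
  have := hc.full
  have := hc.faithful
  choose e he using fun x => h ⟨x, rfl⟩
  let f : a.carrier ⥤ c.carrier :=
    { obj := e
      map := fun {x y} g => c.functor.preimage
        (eqToHom (he x) ≫ a.functor.map g ≫ eqToHom (he y).symm)
      map_id := fun x => c.functor.map_injective (by simp)
      map_comp := fun g g' => c.functor.map_injective (by simp) }
  have w : f ⋙ c.functor = a.functor :=
    CategoryTheory.Functor.ext he fun x y g => by simp [f]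
  exact ⟨⟨f, IsLC.of_comp (T'' := canonicalTopology k C) (G := c.functor)
    (w.symm ▸ a.isLC) c.isLC, w⟩⟩

/-- Full site presentations are subterminal. -/
lemma IsFull.hom_ext {a c : SitePresentation k C} (hc : c.IsFull) (f g : a ⟶ c) : f = g := by
  have := hc.faithful
  have e : f.functor ⋙ c.functor = g.functor ⋙ c.functor := f.w.trans g.w.symm
  refine Hom.ext (CategoryTheory.Functor.ext
    (fun x => hc.obj_injective (Functor.congr_obj e x)) fun x y t => c.functor.map_injective ?_)
  simpa [eqToHom_map] using Functor.congr_hom e t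

/-- Any two site presentations map to a full one, given by the union of their values. -/
lemma exists_isFull (a b : SitePresentation k C) :
    ∃ c : SitePresentation k C, c.IsFull ∧ Nonempty (a ⟶ c) ∧ Nonempty (b ⟶ c) := by
  let S := Set.range a.functor.obj ∪ Set.range b.functor.obj
  let c := ofSet S (isGenerating_incl a S Set.subset_union_left)
  have hc : c.IsFull := isFull_ofSet S _
  have hS : S ⊆ Set.range c.functor.obj := fun X hX => FullModel.exists_obj hX
  exact ⟨c, hc, hc.exists_hom (Set.subset_union_left.trans hS),
    hc.exists_hom (Set.subset_union_right.trans hS)⟩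

end SitePresentation

/-! ### The comparison functor -/

section Sandwich

variable {C : Type u} [Category.{v} C] {W X Y Z : C}

lemma comp_add_comp [Preadditive C] (p : W ⟶ X) (f g : X ⟶ Y) (q : Y ⟶ Z) :
    p ≫ (f + g) ≫ q = p ≫ f ≫ q + p ≫ g ≫ q := by
  rw [Preadditive.add_comp, Preadditive.comp_add]

lemma comp_smul_comp {k : Type w} [CommRing k] [Preadditive C] [Linear k C] (r : k) (p : W ⟶ X)
    (f : X ⟶ Y) (q : Y ⟶ Z) : p ≫ (r • f) ≫ q = r • (p ≫ f ≫ q) := by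
  rw [Linear.smul_comp, Linear.comp_smul]

lemma eq_of_eqToHom_comp_comp_eqToHom (h : W = X) (h' : Y = Z) {f g : X ⟶ Y}
    (e : eqToHom h ≫ f ≫ eqToHom h' = eqToHom h ≫ g ≫ eqToHom h') : f = g :=
  (cancel_mono _).1 ((cancel_epi _).1 e)

end Sandwich

section Comparison

variable (k : Type w) [CommRing k] (C : Type u) [Category.{v} C]

/-- Every object of a Grothendieck category is a value of an LC morphism: the inclusion of the
full subcategory on this object and a separator. -/
lemma exists_sitePresentation [Abelian C] [Linear k C] [IsGrothendieckAbelian.{v} C] (X : C) :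
    ∃ (a : SitePresentation k C) (x : a.carrier), a.functor.obj x = X := by
  obtain ⟨G, hG⟩ := HasSeparator.hasSeparator (C := C)
  let S : Set C := {G, X}
  have h : IsGenerating (canonicalTopology k C) (SitePresentation.FullModel.incl S) := fun Y =>
    mem_canonicalTopology_of_isSeparator hG
      (SitePresentation.FullModel.mem_generate (S := S) (Set.mem_insert G {X}))
  exact ⟨SitePresentation.ofSet S h, SitePresentation.FullModel.exists_obj (by simp [S])⟩

/-- The category `J_C` is filtered: the full site presentations form a cofinal full subcategory
which is a directed preorder. -/
theorem isFiltered_sitePresentation [Abelian C] [Linear k C] [IsGrothendieckAbelian.{v} C] :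
    IsFiltered (SitePresentation k C) where
  cocone_objs a b := by
    obtain ⟨c, -, ⟨f⟩, ⟨g⟩⟩ := SitePresentation.exists_isFull a b
    exact ⟨c, f, g, trivial⟩
  cocone_maps _ b f g := by
    obtain ⟨c, hc, ⟨h⟩, -⟩ := SitePresentation.exists_isFull b b
    exact ⟨c, h, hc.hom_ext _ _⟩
  nonempty := ⟨(exists_sitePresentation k C (separator C)).choose⟩

variable [Preadditive C] [Linear k C] [IsFiltered (SitePresentation k C)]

instance comparison_additive : (comparison k C).Additive where
  map_add {X Y f g} := by
    obtain ⟨c, u, v, f, g, rfl, rfl⟩ := FilteredColim.exists_rep_pair f g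
    have := c.isLC.additive
    refine (congrArg (comparison k C).map (FilteredColim.homMk_add u v f g)).trans ?_
    refine (comparison_map k C u v (f + g)).trans ?_
    refine Eq.trans ?_ (congrArg₂ (· + ·) (comparison_map k C u v f) (comparison_map k C u v g)).symm
    exact (congrArg (fun t => _ ≫ t ≫ _) c.functor.map_add).trans (comp_add_comp _ _ _ _)

instance comparison_linear : (comparison k C).Linear k where
  map_smul {X Y} f r := by
    obtain ⟨c, u, v, f, rfl⟩ := FilteredColim.exists_rep f
    have := c.isLC.additive
    have := c.isLC.linear
    refine (congrArg (comparison k C).map (FilteredColim.homMk_smul k u v r f)).trans ?_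
    refine (comparison_map k C u v (r • f)).trans ?_
    refine Eq.trans ?_ (congrArg (r • ·) (comparison_map k C u v f)).symm
    exact (congrArg (fun t => _ ≫ t ≫ _) (c.functor.map_smul r f)).trans (comp_smul_comp r _ _ _)

instance comparison_faithful : (comparison k C).Faithful where
  map_injective {X Y f g} e := by
    obtain ⟨c, u, v, f, g, rfl, rfl⟩ := FilteredColim.exists_rep_pair f g
    -- Over a full site presentation, a representative is determined by its image in `C`.
    obtain ⟨d, hd, ⟨h⟩, -⟩ := SitePresentation.exists_isFull c c
    have := hd.faithful
    have ef := FilteredColim.homMk_push h rfl rfl f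
    have eg := FilteredColim.homMk_push h rfl rfl g
    refine ef.symm.trans (Eq.trans ?_ eg)
    have e' := (congrArg (comparison k C).map ef).trans
      (e.trans (congrArg (comparison k C).map eg).symm)
    refine congrArg (FilteredColim.homMk (u ≫ h) (v ≫ h)) (d.functor.map_injective ?_)
    exact eq_of_eqToHom_comp_comp_eqToHom _ _ (((comparison_map k C (u ≫ h) (v ≫ h) _).symm.trans
      e').trans (comparison_map k C (u ≫ h) (v ≫ h) _))

/-- A morphism `u_a(x) ⟶ u_b(y)` of `C` lifts to any full site presentation that receives both
`u_a` and `u_b`. -/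
instance comparison_full : (comparison k C).Full where
  map_surjective {X Y} φ := by
    obtain ⟨c, hc, ⟨u⟩, ⟨v⟩⟩ := SitePresentation.exists_isFull X.base Y.base
    have := hc.full
    let φ' : X.base.functor.obj X.fiber ⟶ Y.base.functor.obj Y.fiber := φ
    let f : u.functor.obj X.fiber ⟶ v.functor.obj Y.fiber := c.functor.preimage
      (eqToHom (Functor.congr_obj u.w X.fiber) ≫ φ' ≫
        eqToHom (Functor.congr_obj v.w Y.fiber).symm)
    refine ⟨FilteredColim.homMk u v f, (comparison_map k C u v f).trans ?_⟩
    change _ = φ'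
    simp [f]

end Comparison

end LinearSite

end

theorem mainTheorem3 {k : Type w} [CommRing k] {C : Type u} [Category.{v} C] [Abelian C]
    [Linear k C] [IsGrothendieckAbelian.{v} C] :
    ∃ _ : IsFiltered (LinearSite.SitePresentation k C),
      (LinearSite.comparison k C).Additive ∧
      (LinearSite.comparison k C).Linear k ∧
      (LinearSite.comparison k C).IsEquivalence := by
  have := LinearSite.isFiltered_sitePresentation k C
  refine ⟨this, inferInstance, inferInstance, ⟨inferInstance, inferInstance, ⟨fun X => ?_⟩⟩⟩
  obtain ⟨a, x, rfl⟩ := LinearSite.exists_sitePresentation k C X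
  exact ⟨⟨a, x⟩, ⟨Iso.refl _⟩⟩
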